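/- Let $P_0\neq P_1$ be probability distributions on a measurable space $\mathcal X$ with densities $p_0,p_1$ with respect to a common dominating measure, such that $d_0=D(P_0\|P_1)$ and $d_1=D(P_1\|P_0)$ are both finite. Let $\mathbb E_0,\mathbb E_1$ denote expectation when the samples $x,x_1,x_2,\ldots$ are i.i.d. with law $P_0$ (hypothesis $\mathcal H_0$), respectively $P_1$ (hypothesis $\mathcal H_1$). An opportunistic detection rule (ODR) with maximum sample size $N$ consists of a stopping time $\mathsf T\le N$ of the filtration generated by $x_1,\dots,x_N$ and a measurable terminal decision rule $D:\mathcal X^N\to\{\mathcal H_0,\mathcal H_1\}$; it decides $\mathcal H_1$ if $\mathsf T<N$, and decides $D(x_1,\dots,x_N)$ if $\mathsf T=N$. Let $P_{\mathrm{FA}}$ be the probability under $\mathcal H_0$ that it decides $\mathcal H_1$, let $P_{\mathrm M}$ be the probability under $\mathcal H_1$ that it decides $\mathcal H_0$, and let $T=\mathbb E_1[\mathsf T]$. Call $(\Delta_{\mathrm{FA}},\Delta_{\mathrm M},\eta)\in[0,\infty)\times[0,\infty)\times[0,1]$ achievable if there is a sequence of ODRs, indexed by the maximum sample size $N$, with $\limsup_N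 P_{\mathrm{FA}}<1$ and $\limsup_N P_{\mathrm M}<1$, such that $$\liminf_{N\to\infty}\frac{-\log P_{\mathrm{FA}}}{N}\ge\Delta_{\mathrm{FA}},\qquad \liminf_{N\to\infty}\frac{-\log P_{\mathrm M}}{N}\ge\Delta_{\mathrm M},\qquad \limsup_{N\to\infty}\frac{T}{N}\le\eta$$ (with $-\log 0=+\infty$). Let $\mathcal R(p_0,p_1)$ be the closure of the set of achievable tuples. Then $\mathcal R(p_0,p_1)$ is exactly the set of all $(\Delta_{\mathrm{FA}},\Delta_{\mathrm M},\eta)\in[0,\infty)\times[0,\infty)\times[0,1]$ for which there is a $\nu\in[0,1]$ such that $$\Delta_{\mathrm{FA}}\le\min\Big\{\eta\,d_1,\ \sup_{\alpha>0}\Big\{\alpha\,[d_1-\nu(d_0+d_1)]-\log\mathbb E_0\Big[e^{\alpha\log\frac{p_1(x)}{p_0(x)}}\Big]\Big\}\Big\},$$ $$\Delta_{\mathrm M}\le\sup_{\alpha<0}\Big\{\alpha\,[d_1-\nu(d_0+d_1)]-\log\mathbb E_1\Big[e^{\alpha\log\frac{p_1(x)}{p_0(x)}}\Big]\Big\}.$$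 -/

import Mathlib

open MeasureTheory Filter InformationTheory
open scoped ENNReal Topology

namespace ODR

/-- The filtration generated by `N` successive samples, on the space of sample vectors: the
`σ`-algebra at time `k` is generated by the first `k` coordinates (it is trivial for `k = 0`). -/
def sampleFiltration (X : Type*) [MeasurableSpace X] (N : ℕ) :
    Filtration ℕ (MeasurableSpace.pi : MeasurableSpace (Fin N → X)) where
  seq k := ⨆ i : Fin N, ⨆ _ : (i : ℕ) < k,
    MeasurableSpace.comap (fun x : Fin N → X => x i) inferInstance
  mono' _ _ hjk := iSup_mono fun _ => iSup_le fun hi => le_iSup_of_le (hi.trans_le hjk) le_rfl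
  le' _ := iSup_le fun i => iSup_le fun _ => (measurable_pi_apply i).comap_le

/-- An opportunistic detection rule with maximum sample size `N`: a stopping time that stops
by time `N`, and a terminal decision rule `D : X^N → {H₀, H₁}`, given by the event
`terminal = {D = H₁}`. If the stopping time is `< N` the decision is `H₁`; if it is `N` the
decision is that of `D`. -/
structure Rule (X : Type*) [MeasurableSpace X] (N : ℕ) where
  /-- the stopping time -/
  time : (Fin N → X) → ℕ
  isStoppingTime : IsStoppingTime (sampleFiltration X N) fun x => (time x : WithTop ℕ)
  time_le : ∀ x, time x ≤ N
  /-- the event that the terminal decision rule decides `H₁` -/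
  terminal : Set (Fin N → X)
  measurableSet_terminal : MeasurableSet terminal

section

variable {X : Type*} [MeasurableSpace X]

/-- The law of `N` i.i.d. samples drawn from `P`. -/
noncomputable def iidLaw (P : Measure X) (N : ℕ) : Measure (Fin N → X) :=
  Measure.pi fun _ => P

/-- The event that the rule decides `H₁`. -/
def Rule.decideH1 {N : ℕ} (R : Rule X N) : Set (Fin N → X) :=
  {x | R.time x < N} ∪ {x | R.time x = N ∧ x ∈ R.terminal}

/-- The event that the rule decides `H₀`. -/
def Rule.decideH0 {N : ℕ} (R : Rule X N) : Set (Fin N → X) :=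
  {x | R.time x = N ∧ x ∉ R.terminal}

/-- The false alarm probability, when the null distribution is `P₀`. -/
noncomputable def Rule.falseAlarm {N : ℕ} (R : Rule X N) (P₀ : Measure X) : ℝ≥0∞ :=
  iidLaw P₀ N R.decideH1

/-- The miss probability, when the alternative distribution is `P₁`. -/
noncomputable def Rule.miss {N : ℕ} (R : Rule X N) (P₁ : Measure X) : ℝ≥0∞ :=
  iidLaw P₁ N R.decideH0

/-- The expected stopping time, when the alternative distribution is `P₁`. -/
noncomputable def Rule.expectedStop {N : ℕ} (R : Rule X N) (P₁ : Measure X) : ℝ :=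
  ∫ x, (R.time x : ℝ) ∂iidLaw P₁ N

/-- The normalized exponent `-(log p) / N`, equal to `+∞` if `p = 0` (for `N ≥ 1`). -/
noncomputable def exponent (p : ℝ≥0∞) (N : ℕ) : EReal :=
  -ENNReal.log p / (N : EReal)

/-- The tuple `(ΔFA, ΔM, η)` is achieved by a sequence of rules, one for every maximum sample
size `N`, whose error probabilities both stay bounded away from `1`. -/
def IsAchievable (P₀ P₁ : Measure X) (ΔFA ΔM η : ℝ) : Prop :=
  ∃ R : ∀ N : ℕ, Rule X N,
    limsup (fun N => (R N).falseAlarm P₀) atTop < 1 ∧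
    limsup (fun N => (R N).miss P₁) atTop < 1 ∧
    (ΔFA : EReal) ≤ liminf (fun N => exponent ((R N).falseAlarm P₀) N) atTop ∧
    (ΔM : EReal) ≤ liminf (fun N => exponent ((R N).miss P₁) N) atTop ∧
    limsup (fun N => (((R N).expectedStop P₁ / (N : ℝ) : ℝ) : EReal)) atTop ≤ (η : EReal)

/-- The performance region: the closure of the set of achievable tuples `(ΔFA, ΔM, η)` in
`[0, ∞) × [0, ∞) × [0, 1]`. -/
def performanceRegion (P₀ P₁ : Measure X) : Set (ℝ × ℝ × ℝ) :=
  closure {t | 0 ≤ t.1 ∧ 0 ≤ t.2.1 ∧ t.2.2 ∈ Set.Icc (0 : ℝ) 1 ∧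
    IsAchievable P₀ P₁ t.1 t.2.1 t.2.2}

/-- `log E_Q [exp (α * log (p₁ / p₀))]`, the cumulant generating function under `Q` of the
log-likelihood ratio, equal to `+∞` where the expectation is infinite. -/
noncomputable def llrCgf (P₀ P₁ Q : Measure X) (α : ℝ) : EReal :=
  ENNReal.log (∫⁻ x, ENNReal.ofReal (Real.exp (α * llr P₁ P₀ x)) ∂Q)

/-- `sup_{α > 0} (α θ - log E₀ [exp (α * log (p₁ / p₀))])` -/
noncomputable def rateFA (P₀ P₁ : Measure X) (θ : ℝ) : EReal :=
  ⨆ α : ℝ, ⨆ _ : 0 < α, ((α * θ : ℝ) : EReal) - llrCgf P₀ P₁ P₀ α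

/-- `sup_{α < 0} (α θ - log E₁ [exp (α * log (p₁ / p₀))])` -/
noncomputable def rateMiss (P₀ P₁ : Measure X) (θ : ℝ) : EReal :=
  ⨆ α : ℝ, ⨆ _ : α < 0, ((α * θ : ℝ) : EReal) - llrCgf P₀ P₁ P₁ α

end

end ODR

open ProbabilityTheory

set_option linter.unusedSectionVars false

namespace ODR

/-! ### I.i.d. sample laws: change of measure and the law of large numbers in mean. -/

section

variable {X : Type*} [MeasurableSpace X]

/-! Write `L` for the log-likelihood ratio of `P₁` to `P₀` and `S_k` for its partial sums. The laws
`P_β` proportional to `exp (β L) dP₀`, `β ∈ [0, 1]`, interpolate between `P₀` and `P₁`. With `θ_β`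
the mean of `L` under `P_β`, the divergences of `P_β` from `P₀` and `P₁` are `β θ_β - cgf β` and `(β
- 1) θ_β - cgf β`, which are values of the expressions inside the two suprema at `θ = θ_β`.

Converse. By the strong converse of Stein's lemma (`tendsto_iidLaw_zero_of_exponent`), a false alarm
exponent above `divFA β` makes the `P_β`-probability of deciding `H₁` vanish, and a miss exponent
above `divMiss β` does the same for `H₀`; both cannot happen. So for every `β` at least one exponent
is bounded by its divergence. The two closed sets of such `β` cover `[0, 1]` and are nonempty, hence
meet by connectedness (`exists_tilt`). The parameter `ν` encodes `θ_β`. The bound `η d₁` compares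
Wald's identity with a change of measure at the stopping time (`expectedStop_lower_bound`).

Achievability. Stop once `S_k` reaches a level slightly below `N η d₁`; at the horizon compare `S_N`
with a threshold near `N θ`. Early false alarms obey a maximal inequality, the errors at the horizon
obey Chernoff's bound, and the law of large numbers under `P₁` bounds the delay. The small losses
disappear in the closure. -/

instance iidLaw.isProbabilityMeasure (P : Measure X) [IsProbabilityMeasure P] (N : ℕ) :
    IsProbabilityMeasure (iidLaw P N) := by
  unfold iidLaw; infer_instance

/-- The sum of `f` over the first `k` samples. -/
noncomputable def partialSum {N : ℕ} (f : X → ℝ) (k : ℕ) (x : Fin N → X) : ℝ :=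
  ∑ i ∈ Finset.univ.filter (fun i : Fin N => (i : ℕ) < k), f (x i)

lemma partialSum_self {N : ℕ} (f : X → ℝ) (x : Fin N → X) :
    partialSum f N x = ∑ i, f (x i) := by
  simp [partialSum]

lemma measurable_eval_sampleFiltration {N k : ℕ} {i : Fin N} (hi : (i : ℕ) < k) :
    Measurable[sampleFiltration X N k] fun x : Fin N → X => x i :=
  Measurable.of_comap_le <| le_iSup₂_of_le (f := fun (i : Fin N) (_ : (i : ℕ) < k) =>
    MeasurableSpace.comap (fun x : Fin N → X => x i) inferInstance) i hi le_rfl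

lemma measurable_partialSum_sampleFiltration {N : ℕ} {f : X → ℝ} (hf : Measurable f) (k : ℕ) :
    Measurable[sampleFiltration X N k] (partialSum (N := N) f k) := by
  unfold partialSum
  refine Finset.measurable_fun_sum _ fun i hi => ?_
  exact hf.comp (measurable_eval_sampleFiltration (by simpa using hi))

lemma measurable_partialSum {N : ℕ} {f : X → ℝ} (hf : Measurable f) (k : ℕ) :
    Measurable (partialSum (N := N) f k) :=
  (measurable_partialSum_sampleFiltration hf k).mono ((sampleFiltration X N).le k) le_rfl

lemma iIndepFun_eval (Q : Measure X) [IsProbabilityMeasure Q] (N : ℕ) :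
    iIndepFun (fun (i : Fin N) (x : Fin N → X) => x i) (iidLaw Q N) :=
  iIndepFun_pi (μ := fun _ : Fin N => Q) (X := fun _ => id) fun _ => aemeasurable_id

/-- The first `k` samples are independent of the remaining ones. -/
lemma indep_sampleFiltration (Q : Measure X) [IsProbabilityMeasure Q] (N k : ℕ) :
    Indep (sampleFiltration X N k)
      (⨆ i ∈ {i : Fin N | k ≤ i}, MeasurableSpace.comap (fun x : Fin N → X => x i) inferInstance)
      (iidLaw Q N) := by
  refine indep_iSup_of_disjoint (S := {i : Fin N | (i : ℕ) < k})
    (fun i => (measurable_pi_apply i).comap_le) (iIndepFun_eval Q N).iIndep ?_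
  rw [Set.disjoint_left]
  intro i hi hi'
  simp only [Set.mem_ofPred_eq] at hi hi'
  omega

lemma measurable_eval_future {N k : ℕ} {i : Fin N} (hi : k ≤ i) :
    Measurable[⨆ i ∈ {i : Fin N | k ≤ i},
      MeasurableSpace.comap (fun x : Fin N → X => x i) inferInstance] fun x : Fin N → X => x i :=
  Measurable.of_comap_le <| le_iSup₂_of_le (f := fun (i : Fin N) (_ : i ∈ {i : Fin N | k ≤ i}) =>
    MeasurableSpace.comap (fun x : Fin N → X => x i) inferInstance) i hi le_rfl

lemma map_eval_iidLaw (Q : Measure X) [IsProbabilityMeasure Q] {N : ℕ} (i : Fin N) :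
    (iidLaw Q N).map (fun x => x i) = Q :=
  (measurePreserving_eval (fun _ : Fin N => Q) i).map_eq

lemma lintegral_eval_iidLaw (Q : Measure X) [IsProbabilityMeasure Q] {N : ℕ} (i : Fin N)
    {g : X → ℝ≥0∞} (hg : Measurable g) : ∫⁻ x, g (x i) ∂iidLaw Q N = ∫⁻ x, g x ∂Q :=
  (measurePreserving_eval (fun _ : Fin N => Q) i).lintegral_comp hg

lemma lintegral_prod_iidLaw (Q : Measure X) [IsProbabilityMeasure Q] {N : ℕ} (s : Finset (Fin N))
    {g : Fin N → X → ℝ≥0∞} (hg : ∀ i, Measurable (g i)) :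
    ∫⁻ x, ∏ i ∈ s, g i (x i) ∂iidLaw Q N = ∏ i ∈ s, ∫⁻ x, g i x ∂Q := by
  refine (lintegral_prod_eq_prod_lintegral_of_indepFun s (fun i (x : Fin N → X) => g i (x i))
    ((iIndepFun_eval Q N).comp g hg) fun i => (hg i).comp (measurable_pi_apply i)).trans ?_
  exact Finset.prod_congr rfl fun i _ => lintegral_eval_iidLaw Q i (hg i)

lemma iidLaw_withDensity {P Q : Measure X} [IsProbabilityMeasure P] [IsProbabilityMeasure Q]
    {g : X → ℝ≥0∞} (hg : Measurable g) (hP : P = Q.withDensity g) (N : ℕ) :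
    iidLaw P N = (iidLaw Q N).withDensity fun x => ∏ i, g (x i) := by
  refine Measure.pi_eq fun s hs => ?_
  rw [withDensity_apply _ (MeasurableSet.univ_pi hs), ← lintegral_indicator (.univ_pi hs)]
  have : ∀ x : Fin N → X, (Set.univ.pi s).indicator (fun x => ∏ i, g (x i)) x
      = ∏ i, (s i).indicator g (x i) := by
    intro x
    by_cases hx : x ∈ Set.univ.pi s
    · rw [Set.indicator_of_mem hx]
      exact Finset.prod_congr rfl fun i _ => by rw [Set.indicator_of_mem (hx i trivial)]
    · rw [Set.indicator_of_notMem hx]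
      simp only [Set.mem_pi, Set.mem_univ, true_imp_iff, not_forall] at hx
      obtain ⟨i, hi⟩ := hx
      exact (Finset.prod_eq_zero (Finset.mem_univ i) (Set.indicator_of_notMem hi g)).symm
  simp_rw [this]
  rw [lintegral_prod_iidLaw Q _ fun i => hg.indicator (hs i)]
  refine Finset.prod_congr rfl fun i _ => ?_
  rw [lintegral_indicator (hs i), hP, withDensity_apply _ (hs i)]

/-- Change of measure on events that are determined by the first `k` samples. -/
lemma iidLaw_apply_eq_lintegral {P Q : Measure X} [IsProbabilityMeasure P]
    [IsProbabilityMeasure Q] {f : X → ℝ} (hf : Measurable f)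
    (hP : P = Q.withDensity fun x => ENNReal.ofReal (Real.exp (-f x))) {N k : ℕ}
    {A : Set (Fin N → X)} (hA : MeasurableSet[sampleFiltration X N k] A) :
    iidLaw P N A = ∫⁻ x in A, ENNReal.ofReal (Real.exp (-partialSum f k x)) ∂iidLaw Q N := by
  have hg : Measurable fun x => ENNReal.ofReal (Real.exp (-f x)) := by fun_prop
  have hA' : MeasurableSet A := (sampleFiltration X N).le k A hA
  have hone : ∫⁻ x, ENNReal.ofReal (Real.exp (-f x)) ∂Q = 1 := by
    rw [← setLIntegral_univ, ← withDensity_apply _ MeasurableSet.univ, ← hP, measure_univ]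
  have hexp : ∀ (s : Finset (Fin N)) (x : Fin N → X),
      ∏ i ∈ s, ENNReal.ofReal (Real.exp (-f (x i)))
        = ENNReal.ofReal (Real.exp (-∑ i ∈ s, f (x i))) := by
    intro s x
    rw [← ENNReal.ofReal_prod_of_nonneg fun _ _ => (Real.exp_pos _).le, ← Real.exp_sum,
      Finset.sum_neg_distrib]
  rw [iidLaw_withDensity hg hP N, withDensity_apply _ hA', ← lintegral_indicator hA',
    ← lintegral_indicator hA']
  -- The density splits into a factor depending on the first `k` samples and an independent factor
  -- of integral one.
  have hsplit : ∀ x : Fin N → X, A.indicator (fun x => ∏ i, ENNReal.ofReal (Real.exp (-f (x i)))) x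
      = A.indicator (fun x => ENNReal.ofReal (Real.exp (-partialSum f k x))) x *
        ∏ i ∈ Finset.univ.filter (fun i : Fin N => ¬ (i : ℕ) < k), ENNReal.ofReal (Real.exp (-f (x i))) := by
    intro x
    by_cases hx : x ∈ A
    · rw [Set.indicator_of_mem hx, Set.indicator_of_mem hx, partialSum, ← hexp,
        Finset.prod_filter_mul_prod_filter_not]
    · simp [hx]
  simp_rw [hsplit]
  rw [lintegral_mul_eq_lintegral_mul_lintegral_of_independent_measurableSpace
    ((sampleFiltration X N).le k) (iSup₂_le fun i _ => (measurable_pi_apply i).comap_le)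
    (indep_sampleFiltration Q N k), lintegral_prod_iidLaw Q _ (fun _ => hg), hone]
  · simp
  · refine Measurable.indicator ?_ hA
    have := measurable_partialSum_sampleFiltration (N := N) hf k
    fun_prop
  · refine Finset.measurable_fun_prod _ fun i hi => ?_
    exact hg.comp (measurable_eval_future (by simpa using hi))

lemma iidLaw_le_of_le_partialSum {P Q : Measure X} [IsProbabilityMeasure P]
    [IsProbabilityMeasure Q] {f : X → ℝ} (hf : Measurable f)
    (hP : P = Q.withDensity fun x => ENNReal.ofReal (Real.exp (-f x))) {N k : ℕ}
    {A : Set (Fin N → X)} (hA : MeasurableSet[sampleFiltration X N k] A) {b : ℝ}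
    (hb : ∀ x ∈ A, b ≤ partialSum f k x) :
    iidLaw P N A ≤ ENNReal.ofReal (Real.exp (-b)) * iidLaw Q N A := by
  rw [iidLaw_apply_eq_lintegral hf hP hA, ← setLIntegral_const]
  refine setLIntegral_mono measurable_const fun x hx => ?_
  exact ENNReal.ofReal_le_ofReal (Real.exp_le_exp.2 (neg_le_neg (hb x hx)))

lemma measurableSet_sampleFiltration_self {N : ℕ} {A : Set (Fin N → X)} (hA : MeasurableSet A) :
    MeasurableSet[sampleFiltration X N N] A := by
  have h : (MeasurableSpace.pi : MeasurableSpace (Fin N → X)) ≤ sampleFiltration X N N := by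
    refine iSup_le fun i => ?_
    exact (measurable_eval_sampleFiltration i.2).comap_le
  exact h A hA

lemma iidLaw_le_of_partialSum_le {P Q : Measure X} [IsProbabilityMeasure P]
    [IsProbabilityMeasure Q] {f : X → ℝ} (hf : Measurable f)
    (hP : P = Q.withDensity fun x => ENNReal.ofReal (Real.exp (-f x))) {N : ℕ}
    {A : Set (Fin N → X)} (hA : MeasurableSet A) {b : ℝ}
    (hb : ∀ x ∈ A, partialSum f N x ≤ b) :
    iidLaw Q N A ≤ ENNReal.ofReal (Real.exp b) * iidLaw P N A := by
  have h : ENNReal.ofReal (Real.exp (-b)) * iidLaw Q N A ≤ iidLaw P N A := by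
    rw [iidLaw_apply_eq_lintegral hf hP (measurableSet_sampleFiltration_self hA),
      ← setLIntegral_const]
    refine setLIntegral_mono ?_ fun x hx => ?_
    · have := measurable_partialSum (N := N) hf N
      fun_prop
    · exact ENNReal.ofReal_le_ofReal (Real.exp_le_exp.2 (neg_le_neg (hb x hx)))
  calc iidLaw Q N A
      = ENNReal.ofReal (Real.exp b) * (ENNReal.ofReal (Real.exp (-b)) * iidLaw Q N A) := by
        rw [← mul_assoc, ← ENNReal.ofReal_mul (Real.exp_pos _).le, ← Real.exp_add]
        simp
    _ ≤ _ := by gcongr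

/-- The mean absolute deviation of the sum of `f` over `k` samples with law `Q`. -/
noncomputable def meanDeviation (Q : Measure X) (f : X → ℝ) (k : ℕ) : ℝ :=
  ∫ ω, |∑ i ∈ Finset.range k, f (ω i) - k * ∫ y, f y ∂Q| ∂Measure.infinitePi fun _ : ℕ => Q

/-- Puts all sample sizes on one space of sequences, where the law of large numbers applies to a
single process. -/
lemma map_infinitePi_eq_iidLaw (Q : Measure X) [IsProbabilityMeasure Q] (N : ℕ) :
    (Measure.infinitePi fun _ : ℕ => Q).map (fun ω (i : Fin N) => ω i) = iidLaw Q N := by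
  symm
  refine Measure.pi_eq fun s hs => ?_
  have hm : Measurable fun (ω : ℕ → X) (i : Fin N) => ω i := by fun_prop
  rw [Measure.map_apply hm (.univ_pi hs)]
  have := Measure.infinitePi_pi (μ := fun _ : ℕ => Q) (s := Finset.range N)
    (t := fun i => if h : i < N then s ⟨i, h⟩ else Set.univ)
    (fun i hi => by rw [dif_pos (Finset.mem_range.1 hi)]; exact hs _)
  rw [Finset.prod_range] at this
  simp only [Fin.is_lt, dite_true] at this
  rw [← this]
  congr 1
  ext ω
  simp only [Set.mem_preimage, Set.mem_pi, Set.mem_univ, true_imp_iff, Finset.coe_range,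
    Set.mem_Iio]
  constructor
  · intro h i hi
    rw [dif_pos hi]; exact h ⟨i, hi⟩
  · intro h i
    simpa using h i i.2

lemma partialSum_eq_sum_range {N k : ℕ} (hk : k ≤ N) (f : X → ℝ) (ω : ℕ → X) :
    partialSum f k (fun i : Fin N => ω i) = ∑ i ∈ Finset.range k, f (ω i) := by
  unfold partialSum
  refine Finset.sum_bij (fun i _ => (i : ℕ)) ?_ ?_ ?_ ?_
  · intro i hi; simpa using hi
  · intro i _ j _ h; exact Fin.ext h
  · intro i hi
    exact ⟨⟨i, (Finset.mem_range.1 hi).trans_le hk⟩, by simpa using hi, rfl⟩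
  · intro i _; rfl

lemma integral_abs_partialSum_sub {Q : Measure X} [IsProbabilityMeasure Q] {f : X → ℝ}
    (hf : Measurable f) {N k : ℕ} (hk : k ≤ N) :
    ∫ x, |partialSum f k x - k * ∫ y, f y ∂Q| ∂iidLaw Q N = meanDeviation Q f k := by
  rw [← map_infinitePi_eq_iidLaw, integral_map (Measurable.aemeasurable (by fun_prop)), meanDeviation]
  · simp_rw [partialSum_eq_sum_range hk]
  · have := measurable_partialSum (N := N) hf k
    exact (by fun_prop : Measurable _).aestronglyMeasurable

lemma integrable_eval_iidLaw {Q : Measure X} [IsProbabilityMeasure Q] {f : X → ℝ}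
    (hfi : Integrable f Q) {N : ℕ} (i : Fin N) :
    Integrable (fun x : Fin N → X => f (x i)) (iidLaw Q N) :=
  (measurePreserving_eval (fun _ : Fin N => Q) i).integrable_comp_of_integrable hfi

lemma integral_eval_iidLaw {Q : Measure X} [IsProbabilityMeasure Q] {f : X → ℝ}
    (hf : Measurable f) {N : ℕ} (i : Fin N) :
    ∫ x : Fin N → X, f (x i) ∂iidLaw Q N = ∫ y, f y ∂Q := by
  rw [← integral_map (f := f) (φ := fun x : Fin N → X => x i) (measurable_pi_apply i).aemeasurable
    hf.aestronglyMeasurable, map_eval_iidLaw]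

lemma integrable_partialSum {Q : Measure X} [IsProbabilityMeasure Q] {f : X → ℝ}
    (hfi : Integrable f Q) {N : ℕ} (k : ℕ) :
    Integrable (partialSum (N := N) f k) (iidLaw Q N) :=
  integrable_finsetSum _ fun i _ => integrable_eval_iidLaw hfi i

/-- The strong law in `L¹`; no second moment of `f` is needed. -/
lemma tendsto_meanDeviation_div {Q : Measure X} [IsProbabilityMeasure Q] {f : X → ℝ}
    (hf : Measurable f) (hfi : Integrable f Q) :
    Tendsto (fun k : ℕ => meanDeviation Q f k / k) atTop (𝓝 0) := by
  set μ := Measure.infinitePi fun _ : ℕ => Q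
  have hpres : ∀ i : ℕ, MeasurePreserving (fun ω : ℕ → X => ω i) μ Q :=
    fun i => measurePreserving_eval_infinitePi _ i
  have hint : ∀ i : ℕ, Integrable (fun ω : ℕ → X => f (ω i)) μ :=
    fun i => (hpres i).integrable_comp_of_integrable hfi
  have hindep : iIndepFun (fun (i : ℕ) (ω : ℕ → X) => f (ω i)) μ :=
    iIndepFun_infinitePi fun _ => hf
  have hlaw := strong_law_Lp (μ := μ) le_rfl ENNReal.one_ne_top
    (fun (i : ℕ) (ω : ℕ → X) => f (ω i)) (memLp_one_iff_integrable.2 (hint 0))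
    (fun i j hij => hindep.indepFun hij) (fun i => by
      refine ⟨(hint i).aemeasurable, (hint 0).aemeasurable, ?_⟩
      have h (j : ℕ) : μ.map (fun ω => f (ω j)) = Q.map f := by
        rw [← (hpres j).map_eq, Measure.map_map hf (measurable_pi_apply j)]
        rfl
      rw [h, h])
  have hmean : ∫ ω, f (ω 0) ∂μ = ∫ y, f y ∂Q := by
    rw [← (hpres 0).map_eq, integral_map (measurable_pi_apply 0).aemeasurable
      hf.aestronglyMeasurable]
  have hlaw' := (ENNReal.tendsto_toReal ENNReal.zero_ne_top).comp hlaw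
  rw [ENNReal.toReal_zero] at hlaw'
  refine hlaw'.congr' ?_
  filter_upwards [eventually_gt_atTop 0] with k hk
  have hk' : (0 : ℝ) < k := by exact_mod_cast hk
  simp only [Function.comp_apply]
  rw [hmean, eLpNorm_one_eq_lintegral_enorm, ← integral_norm_eq_lintegral_enorm
    (by
      have : Measurable fun ω : ℕ → X => (k : ℝ)⁻¹ • ∑ i ∈ Finset.range k, f (ω i) - ∫ y, f y ∂Q := by
        simp only [smul_eq_mul]
        fun_prop
      exact this.aestronglyMeasurable), meanDeviation, div_eq_inv_mul, ← integral_const_mul]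
  refine integral_congr_ae (Eventually.of_forall fun ω => ?_)
  simp only [smul_eq_mul, Real.norm_eq_abs]
  rw [← abs_of_pos (inv_pos.2 hk'), ← abs_mul, abs_of_pos (inv_pos.2 hk')]
  congr 1
  field_simp

/-- Markov's inequality for the absolute deviation, in place of Chebyshev's, since the
log-likelihood ratio is only known to be integrable. -/
lemma iidLaw_deviation_le {Q : Measure X} [IsProbabilityMeasure Q] {f : X → ℝ}
    (hf : Measurable f) (hfi : Integrable f Q) {N k : ℕ} (hk : k ≤ N) {c : ℝ} (hc : 0 < c) :
    iidLaw Q N {x | c ≤ |partialSum f k x - k * ∫ y, f y ∂Q|}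
      ≤ ENNReal.ofReal (meanDeviation Q f k / c) := by
  have h := mul_meas_ge_le_integral_of_nonneg
    (μ := iidLaw Q N) (f := fun x => |partialSum f k x - k * ∫ y, f y ∂Q|)
    (Eventually.of_forall fun _ => abs_nonneg _)
    (((integrable_partialSum hfi k).sub (integrable_const _)).abs) c
  rw [integral_abs_partialSum_sub hf hk] at h
  rw [← ofReal_measureReal]
  refine ENNReal.ofReal_le_ofReal ?_
  rwa [le_div_iff₀ hc, mul_comm]

end

/-! ### Error exponents and the strong converse of Stein's lemma. -/

lemma le_exponent_iff {p : ℝ≥0∞} {N : ℕ} (hN : 0 < N) {c : ℝ} :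
    (c : EReal) ≤ exponent p N ↔ p ≤ ENNReal.ofReal (Real.exp (-(N * c))) := by
  have hlog : ENNReal.log (ENNReal.ofReal (Real.exp (-(N * c)))) = ((-(N * c) : ℝ) : EReal) := by
    rw [← EReal.exp_coe, EReal.log_exp]
  have hN' : (0 : EReal) < (N : EReal) := by exact_mod_cast hN
  rw [exponent, EReal.le_div_iff_mul_le hN' (EReal.natCast_ne_top N), ← ENNReal.log_le_log_iff,
    hlog, EReal.coe_neg, EReal.le_neg, EReal.coe_mul, mul_comm, EReal.coe_natCast]

lemma eventually_le_of_lt_liminf_exponent {p : ℕ → ℝ≥0∞} {c : ℝ}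
    (h : (c : EReal) < liminf (fun N => exponent (p N) N) atTop) :
    ∀ᶠ N : ℕ in atTop, p N ≤ ENNReal.ofReal (Real.exp (-(N * c))) := by
  filter_upwards [eventually_lt_of_lt_liminf h, eventually_gt_atTop 0] with N hN hpos
  exact (le_exponent_iff hpos).1 hN.le

section

variable {X : Type*} [MeasurableSpace X]

/-- Stein's lemma (strong converse): if the `P`-probability of events decays at an exponential rate
above the mean of the log-likelihood ratio `f` under `Q`, their `Q`-probability vanishes. -/
lemma tendsto_iidLaw_zero_of_exponent {P Q : Measure X} [IsProbabilityMeasure P]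
    [IsProbabilityMeasure Q] {f : X → ℝ} (hf : Measurable f) (hfi : Integrable f Q)
    (hP : P = Q.withDensity fun x => ENNReal.ofReal (Real.exp (-f x)))
    {A : ∀ N : ℕ, Set (Fin N → X)} (hA : ∀ N, MeasurableSet (A N)) {c : ℝ}
    (hc : ∫ y, f y ∂Q < c)
    (h : ∀ᶠ N : ℕ in atTop, iidLaw P N (A N) ≤ ENNReal.ofReal (Real.exp (-(N * c)))) :
    Tendsto (fun N => iidLaw Q N (A N)) atTop (𝓝 0) := by
  -- Split at the level `N b`. Above it the sum deviates from its mean by more than `N (b - D)`;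
  -- below it the change of measure costs at most `exp (N b)`, leaving `exp (-(N (c - b)))`.
  obtain ⟨b, hb, hbc⟩ := exists_between hc
  set D := ∫ y, f y ∂Q
  have hlim : Tendsto (fun N : ℕ => ENNReal.ofReal (meanDeviation Q f N / N * (b - D)⁻¹)
      + ENNReal.ofReal (Real.exp (-(N * (c - b))))) atTop (𝓝 0) := by
    have h1 := ENNReal.tendsto_ofReal ((tendsto_meanDeviation_div hf hfi).mul_const (b - D)⁻¹)
    have h2 : Tendsto (fun N : ℕ => Real.exp (-(N * (c - b)))) atTop (𝓝 0) :=
      Real.tendsto_exp_neg_atTop_nhds_zero.comp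
        (tendsto_natCast_atTop_atTop.atTop_mul_const (sub_pos.2 hbc))
    simpa using h1.add (ENNReal.tendsto_ofReal h2)
  refine tendsto_of_tendsto_of_tendsto_of_le_of_le' tendsto_const_nhds hlim
    (Eventually.of_forall fun _ => zero_le) ?_
  filter_upwards [h, eventually_gt_atTop 0] with N hN hpos
  have hpos' : (0 : ℝ) < N := by exact_mod_cast hpos
  have hS := measurable_partialSum (N := N) hf N
  have hB : MeasurableSet (A N ∩ {x | partialSum f N x ≤ N * b}) :=
    (hA N).inter (measurableSet_le hS measurable_const)
  calc iidLaw Q N (A N)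
      ≤ iidLaw Q N ({x | N * (b - D) ≤ |partialSum f N x - N * D|}
          ∪ (A N ∩ {x | partialSum f N x ≤ N * b})) := by
        refine measure_mono fun x hx => ?_
        by_cases hxb : partialSum f N x ≤ N * b
        · exact Or.inr ⟨hx, hxb⟩
        · left
          have : N * (b - D) ≤ partialSum f N x - N * D := by
            rw [not_le] at hxb; linarith
          exact this.trans (le_abs_self _)
    _ ≤ _ + _ := measure_union_le _ _
    _ ≤ _ := by
        refine add_le_add ?_ ?_
        · refine (iidLaw_deviation_le hf hfi le_rfl (mul_pos hpos' (sub_pos.2 hb))).trans_eq ?_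
          rw [← div_div, div_eq_mul_inv (_ / _)]
        · refine (iidLaw_le_of_partialSum_le hf hP hB fun x hx => hx.2).trans ?_
          refine (mul_le_mul_right ((measure_mono Set.inter_subset_left).trans hN) _).trans_eq ?_
          rw [← ENNReal.ofReal_mul (Real.exp_pos _).le, ← Real.exp_add]
          ring_nf

/-! ### Stopped sums: Wald's identity and the lower bound on the expected stopping time. -/

namespace Rule

variable {N : ℕ} (R : Rule X N)

lemma measurableSet_time_le (k : ℕ) :
    MeasurableSet[sampleFiltration X N k] {x | R.time x ≤ k} := by
  have := R.isStoppingTime k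
  simpa using this

lemma measurableSet_lt_time (k : ℕ) :
    MeasurableSet[sampleFiltration X N k] {x | k < R.time x} := by
  have := (R.measurableSet_time_le k).compl
  convert this using 1
  ext x; simp

lemma measurableSet_time_eq (k : ℕ) :
    MeasurableSet[sampleFiltration X N k] {x | R.time x = k} := by
  rcases Nat.eq_zero_or_pos k with rfl | hk
  · convert R.measurableSet_time_le 0 using 1
    ext x; simp
  · have h : {x | R.time x = k} = {x | R.time x ≤ k} ∩ {x | k - 1 < R.time x} := by
      ext x
      simp only [Set.mem_ofPred_eq, Set.mem_inter_iff]
      omega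
    rw [h]
    exact MeasurableSet.inter (R.measurableSet_time_le k)
      ((sampleFiltration X N).mono (Nat.sub_le k 1) _ (R.measurableSet_lt_time (k - 1)))

lemma measurable_time : Measurable R.time :=
  measurable_to_countable' fun k => (sampleFiltration X N).le k _ (R.measurableSet_time_eq k)

lemma measurableSet_decideH0 : MeasurableSet R.decideH0 :=
  MeasurableSet.inter (R.measurable_time (measurableSet_singleton N))
    R.measurableSet_terminal.compl

lemma compl_decideH1 : R.decideH1ᶜ = R.decideH0 := by
  ext x
  have := R.time_le x
  simp only [decideH1, decideH0, Set.mem_compl_iff, Set.mem_union, Set.mem_ofPred_eq]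
  rcases this.lt_or_eq with h | h
  · simp [h, h.ne]
  · simp [h]

lemma compl_decideH0 : R.decideH0ᶜ = R.decideH1 := by
  rw [← compl_decideH1, compl_compl]

lemma measurableSet_decideH1 : MeasurableSet R.decideH1 :=
  R.compl_decideH0 ▸ R.measurableSet_decideH0.compl

/-- Stopping before `N` already means deciding `H₁`, so the terminal decision matters only at `k =
N`, when all samples are known. -/
lemma measurableSet_decideH1_inter_time_eq (k : ℕ) :
    MeasurableSet[sampleFiltration X N k] (R.decideH1 ∩ {x | R.time x = k}) := by
  rcases lt_trichotomy k N with hk | rfl | hk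
  · convert R.measurableSet_time_eq k using 1
    ext x
    simp only [decideH1, Set.mem_inter_iff, Set.mem_union, Set.mem_ofPred_eq]
    constructor
    · exact fun h => h.2
    · rintro rfl
      exact ⟨Or.inl hk, rfl⟩
  · exact measurableSet_sampleFiltration_self
      (R.measurableSet_decideH1.inter (R.measurable_time (measurableSet_singleton _)))
  · convert MeasurableSet.empty using 1
    ext x
    have := R.time_le x
    simp only [Set.mem_inter_iff, Set.mem_ofPred_eq, Set.mem_empty_iff_false, iff_false]
    omega

/-- The sum of `f` over the samples taken before stopping. -/
noncomputable def stoppedSum (f : X → ℝ) (x : Fin N → X) : ℝ := partialSum f (R.time x) x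

lemma stoppedSum_eq (f : X → ℝ) (x : Fin N → X) :
    R.stoppedSum f x = ∑ i : Fin N, {x | (i : ℕ) < R.time x}.indicator (fun x => f (x i)) x := by
  simp only [stoppedSum, partialSum, Finset.sum_filter, Set.indicator_apply, Set.mem_ofPred_eq]

lemma measurableSet_lt_time' (k : ℕ) : MeasurableSet {x | k < R.time x} :=
  (sampleFiltration X N).le k _ (R.measurableSet_lt_time k)

lemma measurable_stoppedSum {f : X → ℝ} (hf : Measurable f) : Measurable (R.stoppedSum f) := by
  rw [funext (R.stoppedSum_eq f)]
  exact Finset.measurable_fun_sum _ fun i _ =>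
    (hf.comp (measurable_pi_apply i)).indicator (R.measurableSet_lt_time' i)

lemma integrable_stoppedSum {Q : Measure X} [IsProbabilityMeasure Q] {f : X → ℝ}
    (hfi : Integrable f Q) : Integrable (R.stoppedSum f) (iidLaw Q N) := by
  rw [funext (R.stoppedSum_eq f)]
  exact integrable_finsetSum _ fun i _ =>
    (integrable_eval_iidLaw hfi i).indicator (R.measurableSet_lt_time' i)

lemma time_eq_sum (x : Fin N → X) :
    (R.time x : ℝ) = ∑ i : Fin N, {x | (i : ℕ) < R.time x}.indicator (fun _ => (1 : ℝ)) x := by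
  have h : ∀ i : Fin N, {x | (i : ℕ) < R.time x}.indicator (fun _ => (1 : ℝ)) x
      = if (i : ℕ) < R.time x then 1 else 0 := fun i => by
    simp only [Set.indicator_apply, Set.mem_ofPred_eq]
  simp_rw [h]
  rw [← Finset.sum_range fun i => if i < R.time x then (1 : ℝ) else 0, ← Finset.sum_filter]
  have : (Finset.range N).filter (fun i => i < R.time x) = Finset.range (R.time x) := by
    ext i
    have := R.time_le x
    simp only [Finset.mem_filter, Finset.mem_range]
    omega
  simp [this]

/-- Wald's identity. -/
lemma integral_stoppedSum {Q : Measure X} [IsProbabilityMeasure Q] {f : X → ℝ}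
    (hf : Measurable f) (hfi : Integrable f Q) :
    ∫ x, R.stoppedSum f x ∂iidLaw Q N = (∫ y, f y ∂Q) * R.expectedStop Q := by
  have key : ∀ i : Fin N,
      ∫ x, {x | (i : ℕ) < R.time x}.indicator (fun x => f (x i)) x ∂iidLaw Q N
        = (∫ y, f y ∂Q) *
          ∫ x, {x | (i : ℕ) < R.time x}.indicator (fun _ => (1 : ℝ)) x ∂iidLaw Q N := by
    intro i
    -- Whether sampling continues beyond time `i` depends on the coordinates with index below `i`,
    -- hence is independent of coordinate `i` itself.
    have hind : IndepFun ({x | (i : ℕ) < R.time x}.indicator (fun _ => (1 : ℝ)))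
        (fun x : Fin N → X => f (x i)) (iidLaw Q N) := by
      refine (IndepFun_iff_Indep _ _ _).2 ?_
      refine indep_of_indep_of_le_left (indep_of_indep_of_le_right
        (indep_sampleFiltration Q N i) ?_) ?_
      · exact (hf.comp (measurable_eval_future le_rfl)).comap_le
      · exact (Measurable.indicator measurable_const (R.measurableSet_lt_time i)).comap_le
    rw [mul_comm, ← integral_eval_iidLaw hf i, ← hind.integral_mul_eq_mul_integral]
    · refine integral_congr_ae (Eventually.of_forall fun x => ?_)
      by_cases hx : (i : ℕ) < R.time x <;> simp [hx]
    · exact (measurable_const.indicator (R.measurableSet_lt_time' i)).aestronglyMeasurable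
    · exact (hf.comp (measurable_pi_apply i)).aestronglyMeasurable
  rw [funext (R.stoppedSum_eq f), expectedStop, integral_finsetSum]
  · simp_rw [R.time_eq_sum]
    rw [integral_finsetSum, Finset.mul_sum]
    · exact Finset.sum_congr rfl fun i _ => key i
    · exact fun i _ => (integrable_const _).indicator (R.measurableSet_lt_time' i)
  · exact fun i _ => (integrable_eval_iidLaw hfi i).indicator (R.measurableSet_lt_time' i)

/-- Change of measure on the event of deciding `H₁`. -/
lemma falseAlarm_eq_lintegral {P Q : Measure X} [IsProbabilityMeasure P]
    [IsProbabilityMeasure Q] {f : X → ℝ} (hf : Measurable f)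
    (hP : P = Q.withDensity fun x => ENNReal.ofReal (Real.exp (-f x))) :
    R.falseAlarm P = ∫⁻ x in R.decideH1, ENNReal.ofReal (Real.exp (-R.stoppedSum f x))
      ∂iidLaw Q N := by
  have hU : R.decideH1 = ⋃ k : ℕ, R.decideH1 ∩ {x | R.time x = k} := by
    ext x; simp
  have hd : Pairwise (Function.onFun Disjoint fun k : ℕ => R.decideH1 ∩ {x | R.time x = k}) := by
    intro j k hjk
    rw [Function.onFun, Set.disjoint_left]
    rintro x ⟨_, hx⟩ ⟨_, hx'⟩
    exact hjk (hx.symm.trans hx')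
  have hm : ∀ k : ℕ, MeasurableSet (R.decideH1 ∩ {x | R.time x = k}) := fun k =>
    (sampleFiltration X N).le k _ (R.measurableSet_decideH1_inter_time_eq k)
  rw [falseAlarm, hU, measure_iUnion hd hm, lintegral_iUnion hm hd]
  refine tsum_congr fun k => ?_
  rw [iidLaw_apply_eq_lintegral hf hP (R.measurableSet_decideH1_inter_time_eq k)]
  refine setLIntegral_congr_fun (hm k) fun x hx => ?_
  simp only [stoppedSum]
  rw [hx.2]

/-- Split the mean of the stopped sum `S` by the decision. On `H₁`, integrate `S ≥ N c + 1 - exp (N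
c) exp (-S)`: the integral of `exp (-S)` there is the false alarm probability, so the last term
costs at most 1. On `H₀` the rule stops at `N`, so `S` is the full sum, within `meanDeviation` of `N
D` in mean. Wald's identity evaluates the total. -/
lemma expectedStop_lower_bound {P Q : Measure X} [IsProbabilityMeasure P]
    [IsProbabilityMeasure Q] {f : X → ℝ} (hf : Measurable f) (hfi : Integrable f Q)
    (hP : P = Q.withDensity fun x => ENNReal.ofReal (Real.exp (-f x))) {c : ℝ}
    (hc : c ≤ ∫ y, f y ∂Q) (hR : R.falseAlarm P ≤ ENNReal.ofReal (Real.exp (-(N * c)))) :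
    N * c - 1 - meanDeviation Q f N ≤ (∫ y, f y ∂Q) * R.expectedStop Q := by
  set D := ∫ y, f y ∂Q
  have hS := R.integrable_stoppedSum hfi
  have hexp : Measurable fun x => Real.exp (-R.stoppedSum f x) := by
    have := R.measurable_stoppedSum hf
    fun_prop
  have hH1 := R.measurableSet_decideH1
  have hFA := R.falseAlarm_eq_lintegral hf hP
  have hintexp : IntegrableOn (fun x => Real.exp (-R.stoppedSum f x)) R.decideH1 (iidLaw Q N) := by
    refine ⟨hexp.aestronglyMeasurable, ?_⟩
    rw [hasFiniteIntegral_iff_ofReal (Eventually.of_forall fun _ => (Real.exp_pos _).le), ← hFA]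
    exact measure_lt_top _ _
  have hFAreal : ∫ x in R.decideH1, Real.exp (-R.stoppedSum f x) ∂iidLaw Q N
      ≤ Real.exp (-(N * c)) := by
    rw [integral_eq_lintegral_of_nonneg_ae (Eventually.of_forall fun _ => (Real.exp_pos _).le)
      hexp.aestronglyMeasurable, ← hFA]
    exact ENNReal.toReal_le_of_le_ofReal (Real.exp_pos _).le hR
  have h1 : N * c * (iidLaw Q N).real R.decideH1 - 1
      ≤ ∫ x in R.decideH1, R.stoppedSum f x ∂iidLaw Q N := by
    calc N * c * (iidLaw Q N).real R.decideH1 - 1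
        ≤ (N * c + 1) * (iidLaw Q N).real R.decideH1
            - Real.exp (N * c) * ∫ x in R.decideH1, Real.exp (-R.stoppedSum f x) ∂iidLaw Q N := by
          have : Real.exp (N * c) * ∫ x in R.decideH1, Real.exp (-R.stoppedSum f x) ∂iidLaw Q N
              ≤ 1 := by
            refine (mul_le_mul_of_nonneg_left hFAreal (Real.exp_pos _).le).trans_eq ?_
            rw [← Real.exp_add]; simp
          have h0 : 0 ≤ (iidLaw Q N).real R.decideH1 := measureReal_nonneg
          linarith
      _ = ∫ x in R.decideH1, ((N * c + 1) - Real.exp (N * c) * Real.exp (-R.stoppedSum f x))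
            ∂iidLaw Q N := by
          rw [integral_sub (integrable_const _) (hintexp.const_mul _), integral_const_mul,
            setIntegral_const, smul_eq_mul, mul_comm ((iidLaw Q N).real _)]
      _ ≤ _ := by
          refine integral_mono ((integrable_const _).sub (hintexp.const_mul _))
            hS.integrableOn fun x => ?_
          have := Real.add_one_le_exp (N * c + -R.stoppedSum f x)
          rw [Real.exp_add] at this
          simp only
          linarith
  have h0 : N * D * (iidLaw Q N).real R.decideH0 - meanDeviation Q f N
      ≤ ∫ x in R.decideH0, R.stoppedSum f x ∂iidLaw Q N := by
    have hdev : Integrable (fun x => |partialSum f N x - N * D|) (iidLaw Q N) :=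
      ((integrable_partialSum hfi N).sub (integrable_const _)).abs
    calc N * D * (iidLaw Q N).real R.decideH0 - meanDeviation Q f N
        ≤ N * D * (iidLaw Q N).real R.decideH0
            - ∫ x in R.decideH0, |partialSum f N x - N * D| ∂iidLaw Q N := by
          rw [← integral_abs_partialSum_sub hf (le_refl N)]
          exact sub_le_sub_left (setIntegral_le_integral hdev
            (Eventually.of_forall fun _ => abs_nonneg _)) _
      _ = ∫ x in R.decideH0, (N * D - |partialSum f N x - N * D|) ∂iidLaw Q N := by
          rw [integral_sub (integrable_const _) hdev.integrableOn, setIntegral_const, smul_eq_mul,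
            mul_comm ((iidLaw Q N).real _)]
      _ ≤ _ := by
          refine setIntegral_mono_on ((integrable_const _).sub hdev.integrableOn)
            hS.integrableOn R.measurableSet_decideH0 fun x hx => ?_
          rw [stoppedSum, hx.1]
          linarith [neg_abs_le (partialSum f N x - N * D)]
  have hsplit := integral_add_compl hH1 hS
  rw [R.compl_decideH1, R.integral_stoppedSum hf hfi] at hsplit
  have hone : (iidLaw Q N).real R.decideH1 + (iidLaw Q N).real R.decideH0 = 1 := by
    rw [← R.compl_decideH1, probReal_add_probReal_compl hH1]
  have hle : N * c * (iidLaw Q N).real R.decideH0 ≤ N * D * (iidLaw Q N).real R.decideH0 := by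
    gcongr
  have : N * c = N * c * (iidLaw Q N).real R.decideH1 + N * c * (iidLaw Q N).real R.decideH0 := by
    rw [← mul_add, hone, mul_one]
  linarith

end Rule

end

/-! ### Exponential tilting between the two hypotheses. -/

section

variable {X : Type*} [MeasurableSpace X]

lemma integral_withDensity_exp (P : Measure X) {g : X → ℝ} (hg : Measurable g) (h : X → ℝ) :
    ∫ x, h x ∂P.withDensity (fun x => ENNReal.ofReal (Real.exp (g x)))
      = ∫ x, Real.exp (g x) * h x ∂P := by
  rw [integral_withDensity_eq_integral_toReal_smul (by fun_prop)
    (Eventually.of_forall fun _ => ENNReal.ofReal_lt_top)]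
  simp [ENNReal.toReal_ofReal (Real.exp_pos _).le]

lemma integrable_withDensity_exp_iff (P : Measure X) {g : X → ℝ} (hg : Measurable g) (h : X → ℝ) :
    Integrable h (P.withDensity (fun x => ENNReal.ofReal (Real.exp (g x))))
      ↔ Integrable (fun x => Real.exp (g x) * h x) P := by
  rw [integrable_withDensity_iff_integrable_smul' (by fun_prop)
    (Eventually.of_forall fun _ => ENNReal.ofReal_lt_top)]
  simp [ENNReal.toReal_ofReal (Real.exp_pos _).le]

lemma withDensity_exp_withDensity_exp (P : Measure X) {g h : X → ℝ} (hg : Measurable g)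
    (hh : Measurable h) :
    (P.withDensity fun x => ENNReal.ofReal (Real.exp (g x))).withDensity
        (fun x => ENNReal.ofReal (Real.exp (h x)))
      = P.withDensity fun x => ENNReal.ofReal (Real.exp (g x + h x)) := by
  rw [← withDensity_mul _ (by fun_prop) (by fun_prop)]
  congr 1
  ext x
  rw [Pi.mul_apply, ← ENNReal.ofReal_mul (Real.exp_pos _).le, Real.exp_add]

/-- `L` is a log-likelihood ratio of the mutually absolutely continuous laws `P₁` and `P₀`, with
finite means under both of them. -/
structure IsLogLikelihoodRatio (P₀ P₁ : Measure X) (L : X → ℝ) : Prop where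
  measurable : Measurable L
  eq_withDensity : P₁ = P₀.withDensity fun x => ENNReal.ofReal (Real.exp (L x))
  integrable_zero : Integrable L P₀
  integrable_one : Integrable L P₁

/-- Finiteness of both divergences gives absolute continuity both ways, so the density is almost
everywhere positive and equals the exponential of its logarithm. -/
lemma isLogLikelihoodRatio_llr {P₀ P₁ : Measure X} [IsProbabilityMeasure P₀]
    [IsProbabilityMeasure P₁] (h₀ : klDiv P₀ P₁ ≠ ∞) (h₁ : klDiv P₁ P₀ ≠ ∞) :
    IsLogLikelihoodRatio P₀ P₁ (llr P₁ P₀) := by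
  rw [klDiv_ne_top_iff] at h₀ h₁
  refine ⟨measurable_llr _ _, ?_, ?_, h₁.2⟩
  · conv_lhs => rw [← Measure.withDensity_rnDeriv_eq P₁ P₀ h₁.1]
    refine withDensity_congr_ae ?_
    filter_upwards [exp_llr_of_ac' P₁ P₀ h₀.1, Measure.rnDeriv_lt_top P₁ P₀] with x hx hx'
    rw [hx, ENNReal.ofReal_toReal hx'.ne]
  · have := h₀.2.neg
    rwa [integrable_congr (neg_llr h₀.1)] at this

lemma toReal_klDiv_zero {P₀ P₁ : Measure X} [IsProbabilityMeasure P₀]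
    [IsProbabilityMeasure P₁] (h₀ : klDiv P₀ P₁ ≠ ∞) :
    (klDiv P₀ P₁).toReal = -∫ x, llr P₁ P₀ x ∂P₀ := by
  rw [klDiv_ne_top_iff] at h₀
  rw [toReal_klDiv_of_measure_eq h₀.1 (by simp), ← integral_neg]
  refine integral_congr_ae ?_
  filter_upwards [neg_llr h₀.1] with x hx
  rw [← hx, Pi.neg_apply, neg_neg]

/-- The mean under the exponentially tilted law `exp (β L - log E₀ [exp (β L)]) dP₀`. -/
noncomputable def tiltMean (P₀ : Measure X) (L : X → ℝ) (β : ℝ) : ℝ :=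
  (∫ x, Real.exp (β * L x) * L x ∂P₀) / mgf L P₀ β

/-- The divergence of the tilted law from `P₀`. -/
noncomputable def divFA (P₀ : Measure X) (L : X → ℝ) (β : ℝ) : ℝ :=
  β * tiltMean P₀ L β - cgf L P₀ β

/-- The divergence of the tilted law from `P₁`. -/
noncomputable def divMiss (P₀ : Measure X) (L : X → ℝ) (β : ℝ) : ℝ :=
  (β - 1) * tiltMean P₀ L β - cgf L P₀ β

/-- The exponentially tilted law. -/
noncomputable def tiltLaw (P₀ : Measure X) (L : X → ℝ) (β : ℝ) : Measure X :=
  P₀.withDensity fun x => ENNReal.ofReal (Real.exp (β * L x - cgf L P₀ β))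

/-- A bound uniform in `β`, which allows dominated convergence up to the endpoints of `[0, 1]`,
outside which the moment generating function may be infinite. -/
lemma exp_mul_le_one_add_exp {β y : ℝ} (hβ : β ∈ Set.Icc (0 : ℝ) 1) :
    Real.exp (β * y) ≤ 1 + Real.exp y := by
  rcases le_total y 0 with hy | hy
  · have : Real.exp (β * y) ≤ 1 := Real.exp_le_one_iff.2 (mul_nonpos_of_nonneg_of_nonpos hβ.1 hy)
    linarith [Real.exp_pos y]
  · have : Real.exp (β * y) ≤ Real.exp y := Real.exp_le_exp.2 (mul_le_of_le_one_left hy hβ.2)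
    linarith

namespace IsLogLikelihoodRatio

variable {P₀ P₁ : Measure X} [IsProbabilityMeasure P₀] [IsProbabilityMeasure P₁] {L : X → ℝ}
  (h : IsLogLikelihoodRatio P₀ P₁ L)

include h

omit [IsProbabilityMeasure P₀] [IsProbabilityMeasure P₁] in
lemma eq_withDensity_neg : P₀ = P₁.withDensity fun x => ENNReal.ofReal (Real.exp (-L x)) := by
  have := h.measurable
  rw [h.eq_withDensity, withDensity_exp_withDensity_exp P₀ h.measurable (by fun_prop)]
  simp

lemma integral_one (g : X → ℝ) : ∫ x, g x ∂P₁ = ∫ x, Real.exp (L x) * g x ∂P₀ := by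
  conv_lhs => rw [h.eq_withDensity]
  exact integral_withDensity_exp P₀ h.measurable g

lemma integrable_one_iff (g : X → ℝ) :
    Integrable g P₁ ↔ Integrable (fun x => Real.exp (L x) * g x) P₀ := by
  conv_lhs => rw [h.eq_withDensity]
  exact integrable_withDensity_exp_iff P₀ h.measurable g

lemma integrable_exp : Integrable (fun x => Real.exp (L x)) P₀ := by
  simpa using (h.integrable_one_iff fun _ => 1).1 (integrable_const 1)

lemma integrable_exp_mul {β : ℝ} (hβ : β ∈ Set.Icc (0 : ℝ) 1) :
    Integrable (fun x => Real.exp (β * L x)) P₀ := by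
  have := h.measurable
  refine ((integrable_const 1).add h.integrable_exp).mono'
    (by fun_prop : Measurable _).aestronglyMeasurable (Eventually.of_forall fun x => ?_)
  rw [Real.norm_eq_abs, Real.abs_exp]
  exact exp_mul_le_one_add_exp hβ

/-- The first term is controlled by the mean under `P₀`, the second by the mean under `P₁`; together
they dominate `exp (β L) L` for all `β ∈ [0, 1]`. -/
lemma integrable_dominating :
    Integrable (fun x => |L x| + |Real.exp (L x) * L x|) P₀ :=
  h.integrable_zero.abs.add ((h.integrable_one_iff L).1 h.integrable_one).abs

omit [IsProbabilityMeasure P₀] [IsProbabilityMeasure P₁] h in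
lemma norm_exp_mul_mul_le {β y : ℝ} (hβ : β ∈ Set.Icc (0 : ℝ) 1) :
    ‖Real.exp (β * y) * y‖ ≤ |y| + |Real.exp y * y| := by
  rw [Real.norm_eq_abs, abs_mul, abs_mul, Real.abs_exp, Real.abs_exp]
  have := mul_le_mul_of_nonneg_right (exp_mul_le_one_add_exp (y := y) hβ) (abs_nonneg y)
  linarith

lemma integrable_exp_mul_mul {β : ℝ} (hβ : β ∈ Set.Icc (0 : ℝ) 1) :
    Integrable (fun x => Real.exp (β * L x) * L x) P₀ := by
  have := h.measurable
  exact h.integrable_dominating.mono' (by fun_prop : Measurable _).aestronglyMeasurable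
    (Eventually.of_forall fun x => norm_exp_mul_mul_le hβ)

lemma mgf_pos {β : ℝ} (hβ : β ∈ Set.Icc (0 : ℝ) 1) : 0 < mgf L P₀ β :=
  ProbabilityTheory.mgf_pos (h.integrable_exp_mul hβ)

lemma continuousOn_mgf : ContinuousOn (mgf L P₀) (Set.Icc 0 1) := by
  have := h.measurable
  refine continuousOn_of_dominated (bound := fun x => 1 + Real.exp (L x))
    (fun β _ => (by fun_prop : Measurable _).aestronglyMeasurable)
    (fun β hβ => Eventually.of_forall fun x => ?_)
    ((integrable_const 1).add h.integrable_exp) (Eventually.of_forall fun x => ?_)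
  · rw [Real.norm_eq_abs, Real.abs_exp]
    exact exp_mul_le_one_add_exp hβ
  · fun_prop

lemma continuousOn_cgf : ContinuousOn (cgf L P₀) (Set.Icc 0 1) :=
  h.continuousOn_mgf.log fun _ hβ => (h.mgf_pos hβ).ne'

lemma continuousOn_tiltMean : ContinuousOn (tiltMean P₀ L) (Set.Icc 0 1) := by
  have := h.measurable
  refine ContinuousOn.div ?_ h.continuousOn_mgf fun _ hβ => (h.mgf_pos hβ).ne'
  refine continuousOn_of_dominated (bound := fun x => |L x| + |Real.exp (L x) * L x|)
    (fun β _ => (by fun_prop : Measurable _).aestronglyMeasurable)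
    (fun β hβ => Eventually.of_forall fun x => norm_exp_mul_mul_le hβ)
    h.integrable_dominating (Eventually.of_forall fun x => ?_)
  fun_prop

lemma continuousOn_divFA : ContinuousOn (divFA P₀ L) (Set.Icc 0 1) :=
  (continuousOn_id.mul h.continuousOn_tiltMean).sub h.continuousOn_cgf

lemma continuousOn_divMiss : ContinuousOn (divMiss P₀ L) (Set.Icc 0 1) :=
  ((continuousOn_id.sub continuousOn_const).mul h.continuousOn_tiltMean).sub h.continuousOn_cgf

lemma mgf_one : mgf L P₀ 1 = 1 := by
  have := h.integral_one fun _ => 1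
  simpa [mgf] using this.symm

lemma tiltMean_zero : tiltMean P₀ L 0 = ∫ x, L x ∂P₀ := by
  simp [tiltMean]

lemma tiltMean_one : tiltMean P₀ L 1 = ∫ x, L x ∂P₁ := by
  rw [tiltMean, h.mgf_one, h.integral_one]
  simp

lemma divMiss_zero : divMiss P₀ L 0 = -∫ x, L x ∂P₀ := by
  simp [divMiss, h.tiltMean_zero]

lemma divFA_one : divFA P₀ L 1 = ∫ x, L x ∂P₁ := by
  simp [divFA, h.tiltMean_one, cgf, h.mgf_one]

/-- Since `exp (β ·)` is nondecreasing, `(L - c) (exp (β L) - exp (β c)) ≥ 0`. Integrate over `P₀`: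
the constant `exp (β c)` drops out because `c` is the mean of `L`. -/
lemma le_tiltMean {β : ℝ} (hβ : β ∈ Set.Icc (0 : ℝ) 1) :
    ∫ x, L x ∂P₀ ≤ tiltMean P₀ L β := by
  set c := ∫ x, L x ∂P₀
  rw [tiltMean, le_div_iff₀ (h.mgf_pos hβ)]
  have hnn : 0 ≤ ∫ x, (Real.exp (β * L x) * L x - c * Real.exp (β * L x)
      - Real.exp (β * c) * (L x - c)) ∂P₀ := by
    refine integral_nonneg fun x => ?_
    have : 0 ≤ (L x - c) * (Real.exp (β * L x) - Real.exp (β * c)) := by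
      rcases le_total c (L x) with hx | hx
      · exact mul_nonneg (sub_nonneg.2 hx) (sub_nonneg.2
          (Real.exp_le_exp.2 (mul_le_mul_of_nonneg_left hx hβ.1)))
      · exact mul_nonneg_of_nonpos_of_nonpos (sub_nonpos.2 hx) (sub_nonpos.2
          (Real.exp_le_exp.2 (mul_le_mul_of_nonneg_left hx hβ.1)))
    simp only [Pi.zero_apply]
    linarith
  have hi1 : Integrable (fun x => Real.exp (β * L x) * L x - c * Real.exp (β * L x)) P₀ :=
    (h.integrable_exp_mul_mul hβ).sub ((h.integrable_exp_mul hβ).const_mul c)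
  have hi2 : Integrable (fun x => Real.exp (β * c) * (L x - c)) P₀ :=
    (h.integrable_zero.sub (integrable_const c)).const_mul _
  rw [integral_sub hi1 hi2,
    integral_sub (h.integrable_exp_mul_mul hβ) ((h.integrable_exp_mul hβ).const_mul c),
    integral_const_mul, integral_const_mul, integral_sub h.integrable_zero (integrable_const c)]
    at hnn
  simp only [integral_const, probReal_univ, smul_eq_mul, one_mul] at hnn
  rw [mgf]
  change 0 ≤ _ - Real.exp (β * c) * (c - c) at hnn
  linarith

/-- The same correlation argument under `P₁`, with the nonincreasing function `exp ((β - 1) ·)`; the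
factor `exp L` turns it into an integral over `P₀`. -/
lemma tiltMean_le {β : ℝ} (hβ : β ∈ Set.Icc (0 : ℝ) 1) :
    tiltMean P₀ L β ≤ ∫ x, L x ∂P₁ := by
  set d := ∫ x, L x ∂P₁ with hd
  rw [tiltMean, div_le_iff₀ (h.mgf_pos hβ)]
  have hint := (h.integrable_one_iff L).1 h.integrable_one
  have hnn : 0 ≤ ∫ x, (d * Real.exp (β * L x) - Real.exp (β * L x) * L x
      + Real.exp ((β - 1) * d) * (Real.exp (L x) * L x - d * Real.exp (L x))) ∂P₀ := by
    refine integral_nonneg fun x => ?_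
    have h0 : 0 ≤ (d - L x) * (Real.exp ((β - 1) * L x) - Real.exp ((β - 1) * d)) := by
      have hβ' : β - 1 ≤ 0 := by linarith [hβ.2]
      rcases le_total d (L x) with hx | hx
      · exact mul_nonneg_of_nonpos_of_nonpos (sub_nonpos.2 hx) (sub_nonpos.2
          (Real.exp_le_exp.2 (mul_le_mul_of_nonpos_left hx hβ')))
      · exact mul_nonneg (sub_nonneg.2 hx) (sub_nonneg.2
          (Real.exp_le_exp.2 (mul_le_mul_of_nonpos_left hx hβ')))
    have h1 := mul_nonneg (Real.exp_pos (L x)).le h0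
    have h2 : Real.exp (β * L x) = Real.exp (L x) * Real.exp ((β - 1) * L x) := by
      rw [← Real.exp_add]; ring_nf
    simp only [Pi.zero_apply, h2]
    linarith
  have hi1 : Integrable (fun x => d * Real.exp (β * L x) - Real.exp (β * L x) * L x) P₀ :=
    ((h.integrable_exp_mul hβ).const_mul d).sub (h.integrable_exp_mul_mul hβ)
  have hi2 : Integrable (fun x => Real.exp ((β - 1) * d) *
      (Real.exp (L x) * L x - d * Real.exp (L x))) P₀ :=
    (hint.sub (h.integrable_exp.const_mul d)).const_mul _
  rw [integral_add hi1 hi2,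
    integral_sub ((h.integrable_exp_mul hβ).const_mul d) (h.integrable_exp_mul_mul hβ),
    integral_const_mul, integral_const_mul, integral_sub hint (h.integrable_exp.const_mul d),
    integral_const_mul, ← h.integral_one, ← hd] at hnn
  have h1 := h.mgf_one
  simp only [mgf, one_mul] at h1
  rw [h1] at hnn
  rw [mgf]
  linarith

lemma isProbabilityMeasure_tiltLaw {β : ℝ} (hβ : β ∈ Set.Icc (0 : ℝ) 1) :
    IsProbabilityMeasure (tiltLaw P₀ L β) := by
  refine ⟨?_⟩
  rw [tiltLaw, withDensity_apply _ MeasurableSet.univ, setLIntegral_univ]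
  have he : ∀ x, Real.exp (β * L x - cgf L P₀ β) = Real.exp (β * L x) / mgf L P₀ β := by
    intro x
    rw [Real.exp_sub, cgf, Real.exp_log (h.mgf_pos hβ)]
  simp_rw [he]
  rw [← ofReal_integral_eq_lintegral_ofReal ((h.integrable_exp_mul hβ).div_const _)
    (Eventually.of_forall fun x => div_nonneg (Real.exp_pos _).le (h.mgf_pos hβ).le),
    integral_div]
  change ENNReal.ofReal (mgf L P₀ β / mgf L P₀ β) = 1
  rw [div_self (h.mgf_pos hβ).ne', ENNReal.ofReal_one]

lemma zero_eq_tiltLaw_withDensity (β : ℝ) :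
    P₀ = (tiltLaw P₀ L β).withDensity
      fun x => ENNReal.ofReal (Real.exp (-(β * L x - cgf L P₀ β))) := by
  have := h.measurable
  rw [tiltLaw, withDensity_exp_withDensity_exp _ (by fun_prop) (by fun_prop)]
  simp

/-- Follows from `dP₁ = exp L dP₀`. The function inside the negation has mean `divMiss` under the
tilted law, just as the one in `zero_eq_tiltLaw_withDensity` has mean `divFA`. -/
lemma one_eq_tiltLaw_withDensity (β : ℝ) :
    P₁ = (tiltLaw P₀ L β).withDensity
      fun x => ENNReal.ofReal (Real.exp (-((β - 1) * L x - cgf L P₀ β))) := by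
  have := h.measurable
  rw [tiltLaw, withDensity_exp_withDensity_exp _ (by fun_prop) (by fun_prop), h.eq_withDensity]
  congr 1
  ext x
  congr 2
  ring

lemma exp_mul_sub_cgf {β : ℝ} (hβ : β ∈ Set.Icc (0 : ℝ) 1) (x : X) :
    Real.exp (β * L x - cgf L P₀ β) * L x = Real.exp (β * L x) * L x / mgf L P₀ β := by
  rw [Real.exp_sub, cgf, Real.exp_log (h.mgf_pos hβ)]
  ring

lemma integrable_tiltLaw {β : ℝ} (hβ : β ∈ Set.Icc (0 : ℝ) 1) :
    Integrable L (tiltLaw P₀ L β) := by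
  have := h.measurable
  rw [tiltLaw, integrable_withDensity_exp_iff _ (by fun_prop)]
  simp_rw [h.exp_mul_sub_cgf hβ]
  exact (h.integrable_exp_mul_mul hβ).div_const _

lemma integral_tiltLaw {β : ℝ} (hβ : β ∈ Set.Icc (0 : ℝ) 1) :
    ∫ x, L x ∂tiltLaw P₀ L β = tiltMean P₀ L β := by
  have := h.measurable
  rw [tiltLaw, integral_withDensity_exp _ (by fun_prop)]
  simp_rw [h.exp_mul_sub_cgf hβ]
  rw [integral_div, tiltMean]

lemma integral_affine_tiltLaw {β : ℝ} (hβ : β ∈ Set.Icc (0 : ℝ) 1) (a c : ℝ) :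
    ∫ x, (a * L x - c) ∂tiltLaw P₀ L β = a * tiltMean P₀ L β - c := by
  have := h.isProbabilityMeasure_tiltLaw hβ
  rw [integral_sub ((h.integrable_tiltLaw hβ).const_mul a) (integrable_const c),
    integral_const_mul, h.integral_tiltLaw hβ]
  simp

end IsLogLikelihoodRatio

end

/-! ### Converse bounds on the exponents and the delay. -/

section

variable {X : Type*} [MeasurableSpace X]

lemma Rule.iidLaw_decideH1_add_decideH0 {N : ℕ} (R : Rule X N) (Q : Measure X) [IsProbabilityMeasure Q] :
    iidLaw Q N R.decideH1 + iidLaw Q N R.decideH0 = 1 := by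
  rw [← R.compl_decideH1, prob_add_prob_compl R.measurableSet_decideH1]

/-- Otherwise the miss probability would tend to 1. This is what supplies the endpoint of the tilt
family in the connectedness argument. -/
lemma not_tendsto_decideH1_zero {Q : Measure X} [IsProbabilityMeasure Q] {R : ∀ N : ℕ, Rule X N}
    (hR : limsup (fun N => (R N).miss Q) atTop < 1) :
    ¬ Tendsto (fun N => iidLaw Q N (R N).decideH1) atTop (𝓝 0) := by
  intro h
  have h' : Tendsto (fun N => (R N).miss Q) atTop (𝓝 (1 - 0)) := by
    refine (ENNReal.Tendsto.sub tendsto_const_nhds h (Or.inl ENNReal.one_ne_top)).congr fun N => ?_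
    rw [Rule.miss, ← (R N).iidLaw_decideH1_add_decideH0 Q, ENNReal.add_sub_cancel_left (measure_ne_top _ _)]
  rw [h'.limsup_eq, tsub_zero] at hR
  exact lt_irrefl _ hR

lemma not_tendsto_decideH0_zero {Q : Measure X} [IsProbabilityMeasure Q] {R : ∀ N : ℕ, Rule X N}
    (hR : limsup (fun N => (R N).falseAlarm Q) atTop < 1) :
    ¬ Tendsto (fun N => iidLaw Q N (R N).decideH0) atTop (𝓝 0) := by
  intro h
  have h' : Tendsto (fun N => (R N).falseAlarm Q) atTop (𝓝 (1 - 0)) := by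
    refine (ENNReal.Tendsto.sub tendsto_const_nhds h (Or.inl ENNReal.one_ne_top)).congr fun N => ?_
    rw [Rule.falseAlarm, ← (R N).iidLaw_decideH1_add_decideH0 Q, ENNReal.add_sub_cancel_right (measure_ne_top _ _)]
  rw [h'.limsup_eq, tsub_zero] at hR
  exact lt_irrefl _ hR

namespace IsLogLikelihoodRatio

variable {P₀ P₁ : Measure X} [IsProbabilityMeasure P₀] [IsProbabilityMeasure P₁] {L : X → ℝ}
  (h : IsLogLikelihoodRatio P₀ P₁ L)

include h

lemma lintegral_one {g : X → ℝ≥0∞} (hg : Measurable g) :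
    ∫⁻ x, g x ∂P₁ = ∫⁻ x, ENNReal.ofReal (Real.exp (L x)) * g x ∂P₀ := by
  have := h.measurable
  conv_lhs => rw [h.eq_withDensity]
  exact lintegral_withDensity_eq_lintegral_mul _ (by fun_prop) hg

/-- Stein's lemma with reference law `P₁`, the case `β = 1` of the tilt family. -/
lemma falseAlarm_exponent_le {R : ∀ N : ℕ, Rule X N} {Δ : ℝ}
    (hM : limsup (fun N => (R N).miss P₁) atTop < 1)
    (hΔ : (Δ : EReal) ≤ liminf (fun N => exponent ((R N).falseAlarm P₀) N) atTop) :
    Δ ≤ ∫ x, L x ∂P₁ := by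
  by_contra! hlt
  obtain ⟨c, hc, hcΔ⟩ := exists_between hlt
  exact not_tendsto_decideH1_zero hM (tendsto_iidLaw_zero_of_exponent h.measurable
    h.integrable_one h.eq_withDensity_neg (fun N => (R N).measurableSet_decideH1) hc
    (eventually_le_of_lt_liminf_exponent ((EReal.coe_lt_coe_iff.2 hcΔ).trans_le hΔ)))

lemma miss_exponent_le {R : ∀ N : ℕ, Rule X N} {Δ : ℝ}
    (hFA : limsup (fun N => (R N).falseAlarm P₀) atTop < 1)
    (hΔ : (Δ : EReal) ≤ liminf (fun N => exponent ((R N).miss P₁) N) atTop) :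
    Δ ≤ -∫ x, L x ∂P₀ := by
  by_contra! hlt
  obtain ⟨c, hc, hcΔ⟩ := exists_between hlt
  refine not_tendsto_decideH0_zero hFA (tendsto_iidLaw_zero_of_exponent (f := fun x => -L x)
    (P := P₁) h.measurable.neg h.integrable_zero.neg ?_ (fun N => (R N).measurableSet_decideH0)
    (by rwa [integral_neg])
    (eventually_le_of_lt_liminf_exponent ((EReal.coe_lt_coe_iff.2 hcΔ).trans_le hΔ)))
  simpa using h.eq_withDensity

/-- If both failed, Stein's lemma under the tilted law would make both decisions asymptotically
impossible, though their probabilities add up to 1. -/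
lemma exponent_le_divFA_or_le_divMiss {R : ∀ N : ℕ, Rule X N} {ΔFA ΔM : ℝ}
    (hFA : (ΔFA : EReal) ≤ liminf (fun N => exponent ((R N).falseAlarm P₀) N) atTop)
    (hM : (ΔM : EReal) ≤ liminf (fun N => exponent ((R N).miss P₁) N) atTop)
    {β : ℝ} (hβ : β ∈ Set.Icc (0 : ℝ) 1) :
    ΔFA ≤ divFA P₀ L β ∨ ΔM ≤ divMiss P₀ L β := by
  by_contra! hlt
  obtain ⟨a, ha, haΔ⟩ := exists_between hlt.1
  obtain ⟨b, hb, hbΔ⟩ := exists_between hlt.2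
  have := h.isProbabilityMeasure_tiltLaw hβ
  have hL := h.measurable
  have hLi := h.integrable_tiltLaw hβ
  have h1 := tendsto_iidLaw_zero_of_exponent (Q := tiltLaw P₀ L β)
    (f := fun x => β * L x - cgf L P₀ β) (by fun_prop)
    ((hLi.const_mul β).sub (integrable_const _)) (h.zero_eq_tiltLaw_withDensity β)
    (fun N => (R N).measurableSet_decideH1) (by rwa [h.integral_affine_tiltLaw hβ])
    (eventually_le_of_lt_liminf_exponent ((EReal.coe_lt_coe_iff.2 haΔ).trans_le hFA))
  have h0 := tendsto_iidLaw_zero_of_exponent (Q := tiltLaw P₀ L β)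
    (f := fun x => (β - 1) * L x - cgf L P₀ β) (by fun_prop)
    ((hLi.const_mul (β - 1)).sub (integrable_const _)) (h.one_eq_tiltLaw_withDensity β)
    (fun N => (R N).measurableSet_decideH0) (by rwa [h.integral_affine_tiltLaw hβ])
    (eventually_le_of_lt_liminf_exponent ((EReal.coe_lt_coe_iff.2 hbΔ).trans_le hM))
  have hsum := h1.add h0
  simp_rw [Rule.iidLaw_decideH1_add_decideH0, add_zero] at hsum
  exact one_ne_zero (tendsto_nhds_unique tendsto_const_nhds hsum)

/-- The parameters satisfying either bound form closed subsets of `[0, 1]`; they cover it, one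
contains 1 and the other 0, so connectedness yields a common point. No monotonicity or convexity of
the divergences is used. -/
lemma exists_tilt {R : ∀ N : ℕ, Rule X N} {ΔFA ΔM : ℝ}
    (hFA1 : limsup (fun N => (R N).falseAlarm P₀) atTop < 1)
    (hM1 : limsup (fun N => (R N).miss P₁) atTop < 1)
    (hFA : (ΔFA : EReal) ≤ liminf (fun N => exponent ((R N).falseAlarm P₀) N) atTop)
    (hM : (ΔM : EReal) ≤ liminf (fun N => exponent ((R N).miss P₁) N) atTop) :
    ∃ β ∈ Set.Icc (0 : ℝ) 1, ΔFA ≤ divFA P₀ L β ∧ ΔM ≤ divMiss P₀ L β := by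
  have hA := h.continuousOn_divFA.preimage_isClosed_of_isClosed isClosed_Icc
    (isClosed_Ici (a := ΔFA))
  have hB := h.continuousOn_divMiss.preimage_isClosed_of_isClosed isClosed_Icc
    (isClosed_Ici (a := ΔM))
  have hconn := isPreconnected_closed_iff.1 (isPreconnected_Icc (a := (0 : ℝ)) (b := 1)) _ _ hA hB
    (fun β hβ => (h.exponent_le_divFA_or_le_divMiss hFA hM hβ).imp (fun h => ⟨hβ, h⟩)
      fun h => ⟨hβ, h⟩)
    ⟨1, by simp, by simp, by
      simpa [h.divFA_one] using h.falseAlarm_exponent_le hM1 hFA⟩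
    ⟨0, by simp, by simp, by
      simpa [h.divMiss_zero] using h.miss_exponent_le hFA1 hM⟩
  obtain ⟨β, hβ, h1, h2⟩ := hconn
  exact ⟨β, hβ, h1.2, h2.2⟩

/-- Divide `expectedStop_lower_bound` by `N` and let the deviation term vanish. Its condition that
the exponent not exceed the mean comes from Stein's lemma. -/
lemma falseAlarm_exponent_le_mul {R : ∀ N : ℕ, Rule X N} {Δ η : ℝ} (hd : 0 < ∫ x, L x ∂P₁)
    (hM : limsup (fun N => (R N).miss P₁) atTop < 1)
    (hΔ : (Δ : EReal) ≤ liminf (fun N => exponent ((R N).falseAlarm P₀) N) atTop)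
    (hη : limsup (fun N => (((R N).expectedStop P₁ / (N : ℝ) : ℝ) : EReal)) atTop ≤ (η : EReal)) :
    Δ ≤ η * ∫ x, L x ∂P₁ := by
  have hΔd := h.falseAlarm_exponent_le hM hΔ
  set d := ∫ x, L x ∂P₁
  by_contra! hlt
  obtain ⟨c, hc, hcΔ⟩ := exists_between hlt
  obtain ⟨η', hη', hη'c⟩ := exists_between ((lt_div_iff₀ hd).2 hc)
  rw [lt_div_iff₀ hd] at hη'c
  have hlim : Tendsto (fun N : ℕ => c - (1 / (N : ℝ) + meanDeviation P₁ L N / N)) atTop (𝓝 c) := by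
    simpa using tendsto_const_nhds.sub (tendsto_one_div_atTop_nhds_zero_nat.add
      (tendsto_meanDeviation_div h.measurable h.integrable_one))
  refine hη'c.not_ge (le_of_tendsto hlim ?_)
  filter_upwards [eventually_gt_atTop 0,
    eventually_le_of_lt_liminf_exponent ((EReal.coe_lt_coe_iff.2 hcΔ).trans_le hΔ),
    eventually_lt_of_limsup_lt (hη.trans_lt (EReal.coe_lt_coe_iff.2 hη'))] with N hN hFA hT
  have hN' : (0 : ℝ) < N := by exact_mod_cast hN
  have hT' : (R N).expectedStop P₁ / N < η' := EReal.coe_lt_coe_iff.1 hT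
  have hb := (R N).expectedStop_lower_bound h.measurable h.integrable_one h.eq_withDensity_neg
    (hcΔ.le.trans hΔd) hFA
  change _ ≤ d * _ at hb
  have hb' := div_le_div_of_nonneg_right hb hN'.le
  rw [mul_div_assoc] at hb'
  calc c - (1 / (N : ℝ) + meanDeviation P₁ L N / N)
      = (N * c - 1 - meanDeviation P₁ L N) / N := by field_simp; ring
    _ ≤ d * ((R N).expectedStop P₁ / N) := hb'
    _ ≤ d * η' := mul_le_mul_of_nonneg_left hT'.le hd.le
    _ = η' * d := mul_comm _ _

/-- The projection of a closed set along the compact factor `[0, 1]` of tilt parameters. -/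
lemma isClosed_tiltRegion (d : ℝ) :
    IsClosed {t : ℝ × ℝ × ℝ | 0 ≤ t.1 ∧ 0 ≤ t.2.1 ∧ t.2.2 ∈ Set.Icc (0 : ℝ) 1 ∧
      ∃ β ∈ Set.Icc (0 : ℝ) 1, t.1 ≤ t.2.2 * d ∧ t.1 ≤ divFA P₀ L β ∧
        t.2.1 ≤ divMiss P₀ L β} := by
  have hA := continuousOn_iff_continuous_domRestrict.1 h.continuousOn_divFA
  have hB := continuousOn_iff_continuous_domRestrict.1 h.continuousOn_divMiss
  have hcl : IsClosed {p : (ℝ × ℝ × ℝ) × Set.Icc (0 : ℝ) 1 | 0 ≤ p.1.1 ∧ 0 ≤ p.1.2.1 ∧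
      p.1.2.2 ∈ Set.Icc (0 : ℝ) 1 ∧ p.1.1 ≤ p.1.2.2 * d ∧
      p.1.1 ≤ (Set.Icc (0 : ℝ) 1).domRestrict (divFA P₀ L) p.2 ∧
      p.1.2.1 ≤ (Set.Icc (0 : ℝ) 1).domRestrict (divMiss P₀ L) p.2} := by
    have c1 : IsClosed {p : (ℝ × ℝ × ℝ) × Set.Icc (0 : ℝ) 1 | 0 ≤ p.1.1} :=
      isClosed_le (by fun_prop) (by fun_prop)
    have c2 : IsClosed {p : (ℝ × ℝ × ℝ) × Set.Icc (0 : ℝ) 1 | 0 ≤ p.1.2.1} :=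
      isClosed_le (by fun_prop) (by fun_prop)
    have c3 : IsClosed {p : (ℝ × ℝ × ℝ) × Set.Icc (0 : ℝ) 1 | p.1.2.2 ∈ Set.Icc (0 : ℝ) 1} :=
      isClosed_Icc.preimage (by fun_prop)
    have c4 : IsClosed {p : (ℝ × ℝ × ℝ) × Set.Icc (0 : ℝ) 1 | p.1.1 ≤ p.1.2.2 * d} :=
      isClosed_le (by fun_prop) (by fun_prop)
    have c5 : IsClosed {p : (ℝ × ℝ × ℝ) × Set.Icc (0 : ℝ) 1 |
        p.1.1 ≤ (Set.Icc (0 : ℝ) 1).domRestrict (divFA P₀ L) p.2} :=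
      isClosed_le (by fun_prop) (hA.comp continuous_snd)
    have c6 : IsClosed {p : (ℝ × ℝ × ℝ) × Set.Icc (0 : ℝ) 1 |
        p.1.2.1 ≤ (Set.Icc (0 : ℝ) 1).domRestrict (divMiss P₀ L) p.2} :=
      isClosed_le (by fun_prop) (hB.comp continuous_snd)
    exact c1.inter (c2.inter (c3.inter (c4.inter (c5.inter c6))))
  convert isClosedMap_fst_of_compactSpace _ hcl using 1
  ext t
  constructor
  · rintro ⟨h1, h2, h3, β, hβ, h4⟩
    exact ⟨(t, ⟨β, hβ⟩), ⟨h1, h2, h3, h4⟩, rfl⟩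
  · rintro ⟨⟨t', β⟩, ⟨h1, h2, h3, h4⟩, rfl⟩
    exact ⟨h1, h2, h3, β, β.2, h4⟩

lemma performanceRegion_subset_tiltRegion (hd : 0 < ∫ x, L x ∂P₁) :
    performanceRegion P₀ P₁ ⊆
      {t : ℝ × ℝ × ℝ | 0 ≤ t.1 ∧ 0 ≤ t.2.1 ∧ t.2.2 ∈ Set.Icc (0 : ℝ) 1 ∧
        ∃ β ∈ Set.Icc (0 : ℝ) 1, t.1 ≤ t.2.2 * ∫ x, L x ∂P₁ ∧ t.1 ≤ divFA P₀ L β ∧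
          t.2.1 ≤ divMiss P₀ L β} := by
  refine closure_minimal ?_ (h.isClosed_tiltRegion _)
  rintro ⟨ΔFA, ΔM, η⟩ ⟨h1, h2, h3, R, hFA1, hM1, hFA, hM, hT⟩
  obtain ⟨β, hβ, hb1, hb2⟩ := h.exists_tilt hFA1 hM1 hFA hM
  exact ⟨h1, h2, h3, β, hβ, h.falseAlarm_exponent_le_mul hd hM1 hFA hT, hb1, hb2⟩

end IsLogLikelihoodRatio

/-! ### From tilt parameters to the Legendre transforms. -/

section Rates

variable {P₀ P₁ : Measure X} [IsProbabilityMeasure P₀] [IsProbabilityMeasure P₁]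
  (h : IsLogLikelihoodRatio P₀ P₁ (llr P₁ P₀))

include h

lemma llrCgf_zero {β : ℝ} (hβ : β ∈ Set.Icc (0 : ℝ) 1) :
    llrCgf P₀ P₁ P₀ β = (cgf (llr P₁ P₀) P₀ β : ℝ) := by
  rw [llrCgf, ← ofReal_integral_eq_lintegral_ofReal (h.integrable_exp_mul hβ)
    (Eventually.of_forall fun x => (Real.exp_pos _).le)]
  exact ENNReal.log_ofReal_of_pos (h.mgf_pos hβ)

/-- The density `exp L` shifts the parameter by one, so the range `α < 0` under `P₁` becomes `β < 1`
under `P₀`. -/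
lemma llrCgf_one (α : ℝ) : llrCgf P₀ P₁ P₁ α = llrCgf P₀ P₁ P₀ (α + 1) := by
  rw [llrCgf, llrCgf]
  have := h.measurable
  rw [h.lintegral_one (by fun_prop)]
  congr 1
  refine lintegral_congr fun x => ?_
  rw [← ENNReal.ofReal_mul (Real.exp_pos _).le, ← Real.exp_add]
  ring_nf

/-- The supremum omits `β = 0`, which is reached as a limit from `(0, 1]` by continuity of the
cumulant generating function; `le_rateMiss` handles `β = 1` likewise. -/
lemma le_rateFA {β : ℝ} (hβ : β ∈ Set.Icc (0 : ℝ) 1) (θ : ℝ) :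
    ((β * θ - cgf (llr P₁ P₀) P₀ β : ℝ) : EReal) ≤ rateFA P₀ P₁ θ := by
  have hcl : β ∈ closure (Set.Ioc (0 : ℝ) 1) := by rwa [closure_Ioc zero_ne_one]
  have := mem_closure_iff_nhdsWithin_neBot.1 hcl
  have hcont : Tendsto (fun γ => γ * θ - cgf (llr P₁ P₀) P₀ γ) (𝓝[Set.Ioc 0 1] β)
      (𝓝 (β * θ - cgf (llr P₁ P₀) P₀ β)) :=
    (((continuousOn_id.mul continuousOn_const).sub h.continuousOn_cgf) β hβ).mono
      Set.Ioc_subset_Icc_self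
  refine le_of_tendsto ((continuous_coe_real_ereal.tendsto _).comp hcont) ?_
  filter_upwards [self_mem_nhdsWithin] with γ hγ
  refine le_iSup₂_of_le γ hγ.1 ?_
  rw [llrCgf_zero h (Set.Ioc_subset_Icc_self hγ)]
  exact (EReal.coe_sub _ _).le

lemma le_rateMiss {β : ℝ} (hβ : β ∈ Set.Icc (0 : ℝ) 1) (θ : ℝ) :
    (((β - 1) * θ - cgf (llr P₁ P₀) P₀ β : ℝ) : EReal) ≤ rateMiss P₀ P₁ θ := by
  have hcl : β ∈ closure (Set.Ico (0 : ℝ) 1) := by rwa [closure_Ico zero_ne_one]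
  have := mem_closure_iff_nhdsWithin_neBot.1 hcl
  have hcont : Tendsto (fun γ => (γ - 1) * θ - cgf (llr P₁ P₀) P₀ γ) (𝓝[Set.Ico 0 1] β)
      (𝓝 ((β - 1) * θ - cgf (llr P₁ P₀) P₀ β)) :=
    ((((continuousOn_id.sub continuousOn_const).mul continuousOn_const).sub
      h.continuousOn_cgf) β hβ).mono Set.Ico_subset_Icc_self
  refine le_of_tendsto ((continuous_coe_real_ereal.tendsto _).comp hcont) ?_
  filter_upwards [self_mem_nhdsWithin] with γ hγ
  refine le_iSup₂_of_le (γ - 1) (sub_neg.2 hγ.2) ?_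
  rw [llrCgf_one h, sub_add_cancel, llrCgf_zero h (Set.Ico_subset_Icc_self hγ)]
  exact (EReal.coe_sub _ _).le

/-- The converse part: the performance region satisfies the stated bounds. -/
lemma performanceRegion_subset {d₀ d₁ : ℝ} (hd₀ : d₀ = -∫ x, llr P₁ P₀ x ∂P₀)
    (hd₁ : d₁ = ∫ x, llr P₁ P₀ x ∂P₁) (hpos₀ : 0 < d₀) (hpos₁ : 0 < d₁) :
    performanceRegion P₀ P₁ ⊆
      {t : ℝ × ℝ × ℝ | 0 ≤ t.1 ∧ 0 ≤ t.2.1 ∧ t.2.2 ∈ Set.Icc (0 : ℝ) 1 ∧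
        ∃ ν ∈ Set.Icc (0 : ℝ) 1,
          (t.1 : EReal) ≤ min ((t.2.2 * d₁ : ℝ) : EReal)
            (rateFA P₀ P₁ (d₁ - ν * (d₀ + d₁))) ∧
          (t.2.1 : EReal) ≤ rateMiss P₀ P₁ (d₁ - ν * (d₀ + d₁))} := by
  intro t ht
  obtain ⟨h1, h2, h3, β, hβ, h4, h5, h6⟩ := h.performanceRegion_subset_tiltRegion (hd₁ ▸ hpos₁) ht
  rw [← hd₁] at h4
  set θ := tiltMean P₀ (llr P₁ P₀) β with hθ
  have hθ0 : -d₀ ≤ θ := by rw [hd₀, neg_neg]; exact h.le_tiltMean hβ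
  have hθ1 : θ ≤ d₁ := by rw [hd₁]; exact h.tiltMean_le hβ
  have hsum : 0 < d₀ + d₁ := add_pos hpos₀ hpos₁
  -- The witness `ν` solves `d₁ - ν (d₀ + d₁) = θ`; it lies in `[0, 1]` because `-d₀ ≤ θ ≤ d₁`.
  have hν : d₁ - (d₁ - θ) / (d₀ + d₁) * (d₀ + d₁) = θ := by
    rw [div_mul_cancel₀ _ hsum.ne']; ring
  refine ⟨h1, h2, h3, (d₁ - θ) / (d₀ + d₁),
    ⟨div_nonneg (by linarith) hsum.le, (div_le_one hsum).2 (by linarith)⟩, ?_, ?_⟩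
  · rw [hν]
    exact le_min (EReal.coe_le_coe_iff.2 h4)
      ((EReal.coe_le_coe_iff.2 h5).trans (le_rateFA h hβ θ))
  · rw [hν]
    exact (EReal.coe_le_coe_iff.2 h6).trans (le_rateMiss h hβ θ)

end Rates

end

/-- The factor 2 leaves room for a union bound over two error events; `log 2 / N` tends to zero. -/
lemma le_liminf_exponent {p : ℕ → ℝ≥0∞} {c : ℝ}
    (h : ∀ᶠ N : ℕ in atTop, p N ≤ 2 * ENNReal.ofReal (Real.exp (-(N * c)))) :
    (c : EReal) ≤ liminf (fun N => exponent (p N) N) atTop := by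
  refine EReal.ge_of_forall_gt_iff_ge.1 fun b hb => ?_
  have hbc : b < c := EReal.coe_lt_coe_iff.1 hb
  refine le_liminf_of_le (by isBoundedDefault) ?_
  have hlim : Tendsto (fun N : ℕ => (N : ℝ) * (c - b)) atTop atTop :=
    tendsto_natCast_atTop_atTop.atTop_mul_const (sub_pos.2 hbc)
  filter_upwards [h, eventually_gt_atTop 0, hlim.eventually_ge_atTop (Real.log 2)] with N hN hpos hl
  rw [le_exponent_iff hpos]
  refine hN.trans ?_
  rw [← ENNReal.ofReal_ofNat, ← ENNReal.ofReal_mul zero_le_two]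
  refine ENNReal.ofReal_le_ofReal ?_
  rw [← Real.exp_log (zero_lt_two (α := ℝ)), ← Real.exp_add, Real.exp_le_exp]
  linarith

/-! ### Threshold rules, the maximal inequality and Chernoff bounds. -/

section

variable {X : Type*} [MeasurableSpace X]

/-- The rule that stops as soon as the partial sums of `f` reach `a`, with a terminal decision that
compares the total sum with `b`. -/
noncomputable def thresholdRule {f : X → ℝ} (hf : Measurable f) (N : ℕ) (a b : ℝ) : Rule X N where
  -- Including `N` keeps the set nonempty and caps the time; a first crossing exactly at `N` is left
  -- to the terminal decision.
  time x := sInf {k | k = N ∨ a ≤ partialSum f k x}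
  isStoppingTime k := by
    rcases le_or_gt N k with hk | hk
    · convert MeasurableSet.univ using 1
      ext x
      simp only [Set.mem_ofPred_eq, Set.mem_univ, iff_true, Nat.cast_withTop, WithTop.coe_le_coe]
      exact (Nat.sInf_le (Or.inl rfl)).trans hk
    · have : {x : Fin N → X | ((sInf {k | k = N ∨ a ≤ partialSum f k x} : ℕ) : WithTop ℕ) ≤ k}
          = ⋃ j ∈ Set.Iic k, {x | a ≤ partialSum f j x} := by
        ext x
        simp only [Set.mem_ofPred_eq, Nat.cast_withTop, WithTop.coe_le_coe, Set.mem_iUnion,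
          Set.mem_Iic, exists_prop]
        constructor
        · intro h
          rcases Nat.sInf_mem (s := {k | k = N ∨ a ≤ partialSum f k x}) ⟨N, Or.inl rfl⟩ with h' | h'
          · omega
          · exact ⟨_, h, h'⟩
        · rintro ⟨j, hj, hx⟩
          exact (Nat.sInf_le (Or.inr hx)).trans hj
      change MeasurableSet[sampleFiltration X N k] {x : Fin N → X |
        ((sInf {k | k = N ∨ a ≤ partialSum f k x} : ℕ) : WithTop ℕ) ≤ k}
      rw [this]
      refine MeasurableSet.biUnion (Set.to_countable _) fun j hj => ?_
      exact (sampleFiltration X N).mono hj _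
        (measurableSet_le measurable_const (measurable_partialSum_sampleFiltration hf j))
  time_le x := Nat.sInf_le (Or.inl rfl)
  terminal := {x | b ≤ partialSum f N x}
  measurableSet_terminal := measurableSet_le measurable_const (measurable_partialSum hf N)

lemma thresholdRule_le_partialSum {f : X → ℝ} (hf : Measurable f) {N : ℕ} {a b : ℝ}
    {x : Fin N → X} (hx : (thresholdRule hf N a b).time x < N) :
    a ≤ partialSum f ((thresholdRule hf N a b).time x) x := by
  rcases Nat.sInf_mem (s := {k | k = N ∨ a ≤ partialSum f k x}) ⟨N, Or.inl rfl⟩ with h | h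
  · exact absurd h hx.ne
  · exact h

lemma thresholdRule_time_le {f : X → ℝ} (hf : Measurable f) {N k : ℕ} {a b : ℝ}
    {x : Fin N → X} (hx : a ≤ partialSum f k x) : (thresholdRule hf N a b).time x ≤ k :=
  Nat.sInf_le (Or.inr hx)

/-- A maximal inequality for the likelihood ratio. -/
lemma iidLaw_thresholdRule_time_lt_le {P Q : Measure X} [IsProbabilityMeasure P]
    [IsProbabilityMeasure Q] {f : X → ℝ} (hf : Measurable f)
    (hP : P = Q.withDensity fun x => ENNReal.ofReal (Real.exp (-f x))) (N : ℕ) (a b : ℝ) :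
    iidLaw P N {x | (thresholdRule hf N a b).time x < N} ≤ ENNReal.ofReal (Real.exp (-a)) := by
  set R := thresholdRule hf N a b
  have hU : {x | R.time x < N} = ⋃ k ∈ Finset.range N, {x | R.time x = k} := by
    ext x; simp
  have hd : (Finset.range N : Set ℕ).PairwiseDisjoint fun k => {x | R.time x = k} := by
    intro j _ k _ hjk
    rw [Function.onFun, Set.disjoint_left]
    exact fun x hx hx' => hjk (hx.symm.trans hx')
  have hm : ∀ k ∈ Finset.range N, MeasurableSet {x | R.time x = k} := fun k _ =>
    (sampleFiltration X N).le k _ (R.measurableSet_time_eq k)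
  calc iidLaw P N {x | R.time x < N}
      = ∑ k ∈ Finset.range N, iidLaw P N {x | R.time x = k} := by
        rw [hU, measure_biUnion_finset hd hm]
    _ ≤ ∑ k ∈ Finset.range N, ENNReal.ofReal (Real.exp (-a)) * iidLaw Q N {x | R.time x = k} := by
        refine Finset.sum_le_sum fun k hk => ?_
        -- At a stopping time `k < N` the level has been reached, so `P` is at most `exp (-a)` times
        -- `Q` on this piece, and the `Q`-masses of the disjoint pieces sum to at most 1.
        refine iidLaw_le_of_le_partialSum hf hP (R.measurableSet_time_eq k) fun x hx => ?_
        have hx' : R.time x = k := hx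
        have := thresholdRule_le_partialSum hf (a := a) (b := b) (x := x)
          (hx'.trans_lt (Finset.mem_range.1 hk))
        change a ≤ partialSum f (R.time x) x at this
        rwa [hx'] at this
    _ = ENNReal.ofReal (Real.exp (-a)) * iidLaw Q N {x | R.time x < N} := by
        rw [← Finset.mul_sum, ← measure_biUnion_finset hd hm, hU]
    _ ≤ ENNReal.ofReal (Real.exp (-a)) := mul_le_of_le_one_right' prob_le_one

/-- Chernoff's bound for the sum of i.i.d. samples. -/
lemma iidLaw_chernoff {P : Measure X} [IsProbabilityMeasure P] {f : X → ℝ} (hf : Measurable f)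
    {α θ c : ℝ}
    (h : ∫⁻ x, ENNReal.ofReal (Real.exp (α * f x)) ∂P ≤ ENNReal.ofReal (Real.exp (α * θ - c)))
    (N : ℕ) :
    iidLaw P N {x | α * (N * θ) ≤ α * partialSum f N x} ≤ ENNReal.ofReal (Real.exp (-(N * c))) := by
  have hS := measurable_partialSum (N := N) hf N
  have hprod : ∀ x : Fin N → X, ENNReal.ofReal (Real.exp (α * partialSum f N x))
      = ∏ i : Fin N, ENNReal.ofReal (Real.exp (α * f (x i))) := by
    intro x
    rw [← ENNReal.ofReal_prod_of_nonneg fun _ _ => (Real.exp_pos _).le, ← Real.exp_sum,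
      partialSum_self, Finset.mul_sum]
  have hint : ∫⁻ x, ENNReal.ofReal (Real.exp (α * partialSum f N x)) ∂iidLaw P N
      ≤ ENNReal.ofReal (Real.exp (N * (α * θ - c))) := by
    simp_rw [hprod]
    rw [lintegral_prod_iidLaw P Finset.univ
      (g := fun _ x => ENNReal.ofReal (Real.exp (α * f x))) fun _ => by fun_prop]
    simp only [Finset.prod_const, Finset.card_univ, Fintype.card_fin]
    refine (pow_le_pow_left' h N).trans_eq ?_
    rw [← ENNReal.ofReal_pow (Real.exp_pos _).le, ← Real.exp_nat_mul]
  have hmarkov := mul_meas_ge_le_lintegral₀ (μ := iidLaw P N)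
    (f := fun x => ENNReal.ofReal (Real.exp (α * partialSum f N x))) (by fun_prop)
    (ENNReal.ofReal (Real.exp (α * (N * θ))))
  have hset : {x : Fin N → X | α * (N * θ) ≤ α * partialSum f N x}
      = {x | ENNReal.ofReal (Real.exp (α * (N * θ)))
          ≤ ENNReal.ofReal (Real.exp (α * partialSum f N x))} := by
    ext x
    simp only [Set.mem_ofPred_eq]
    rw [ENNReal.ofReal_le_ofReal_iff (Real.exp_pos _).le, Real.exp_le_exp]
  rw [hset]
  set A : Set (Fin N → X) := {x | ENNReal.ofReal (Real.exp (α * (N * θ)))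
    ≤ ENNReal.ofReal (Real.exp (α * partialSum f N x))}
  calc iidLaw P N A = ENNReal.ofReal (Real.exp (-(α * (N * θ)))) *
        (ENNReal.ofReal (Real.exp (α * (N * θ))) * iidLaw P N A) := by
        rw [← mul_assoc, ← ENNReal.ofReal_mul (Real.exp_pos _).le, ← Real.exp_add,
          neg_add_cancel, Real.exp_zero, ENNReal.ofReal_one, one_mul]
    _ ≤ ENNReal.ofReal (Real.exp (-(α * (N * θ)))) *
        ENNReal.ofReal (Real.exp (N * (α * θ - c))) := by
        gcongr
        exact hmarkov.trans hint
    _ = _ := by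
        rw [← ENNReal.ofReal_mul (Real.exp_pos _).le, ← Real.exp_add]
        ring_nf

/-- Only the right-hand side depends on `θ'`, and the strict inequality at `θ` leaves room to move
it. -/
lemma eventually_lintegral_exp_le {P : Measure X} {f : X → ℝ} {α θ c : ℝ}
    (h : (c : EReal) < ((α * θ : ℝ) : EReal) -
      ENNReal.log (∫⁻ x, ENNReal.ofReal (Real.exp (α * f x)) ∂P)) :
    ∀ᶠ θ' in 𝓝 θ, ∫⁻ x, ENNReal.ofReal (Real.exp (α * f x)) ∂P
      ≤ ENNReal.ofReal (Real.exp (α * θ' - c)) := by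
  set I := ∫⁻ x, ENNReal.ofReal (Real.exp (α * f x)) ∂P
  have hlog : ENNReal.log I < ((α * θ - c : ℝ) : EReal) := by
    rw [EReal.coe_sub]
    induction hI : ENNReal.log I with
    | bot => rw [← EReal.coe_sub]; exact EReal.bot_lt_coe _
    | top => rw [hI] at h; simp at h
    | coe r =>
      rw [hI] at h
      norm_cast at h ⊢
      linarith
  obtain ⟨r, hr, hr'⟩ := EReal.lt_iff_exists_real_btwn.1 hlog
  have hI : I ≤ ENNReal.ofReal (Real.exp r) := by
    rw [← ENNReal.log_le_log_iff, ← EReal.exp_coe, EReal.log_exp]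
    exact hr.le
  have hcont : Tendsto (fun θ' => α * θ' - c) (𝓝 θ) (𝓝 (α * θ - c)) :=
    (by fun_prop : Continuous fun θ' : ℝ => α * θ' - c).tendsto θ
  filter_upwards [hcont.eventually_const_lt (EReal.coe_lt_coe_iff.1 hr')] with θ' hθ'
  exact hI.trans (ENNReal.ofReal_le_ofReal (Real.exp_le_exp.2 hθ'.le))

section Tails

variable {P₀ P₁ : Measure X} [IsProbabilityMeasure P₀] [IsProbabilityMeasure P₁]

/-- For `Δ > 0` the factor `1 - ε` makes the inequality strict, so one exponent `α` in the supremum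
attains it and works for all nearby thresholds by Chernoff's bound. For `Δ = 0` the bound is
trivial. -/
lemma eventually_falseAlarm_tail_le {Δ ε θ : ℝ} (hΔ : 0 ≤ Δ) (hε : 0 < ε)
    (h : (Δ : EReal) ≤ rateFA P₀ P₁ θ) :
    ∀ᶠ θ' in 𝓝 θ, ∀ N : ℕ, iidLaw P₀ N {x | N * θ' ≤ partialSum (llr P₁ P₀) N x}
      ≤ ENNReal.ofReal (Real.exp (-(N * ((1 - ε) * Δ)))) := by
  rcases hΔ.eq_or_lt with rfl | hΔ
  · simp [prob_le_one]
  have hlt : (((1 - ε) * Δ : ℝ) : EReal) < rateFA P₀ P₁ θ :=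
    (EReal.coe_lt_coe_iff.2 (by nlinarith)).trans_le h
  simp only [rateFA, lt_iSup_iff] at hlt
  obtain ⟨α, hα, hlt⟩ := hlt
  filter_upwards [eventually_lintegral_exp_le hlt] with θ' hθ' N
  refine le_trans (measure_mono fun x hx => ?_)
    (iidLaw_chernoff (measurable_llr P₁ P₀) hθ' N)
  exact mul_le_mul_of_nonneg_left hx hα.le

lemma eventually_miss_tail_le {Δ ε θ : ℝ} (hΔ : 0 ≤ Δ) (hε : 0 < ε)
    (h : (Δ : EReal) ≤ rateMiss P₀ P₁ θ) :
    ∀ᶠ θ' in 𝓝 θ, ∀ N : ℕ, iidLaw P₁ N {x | partialSum (llr P₁ P₀) N x < N * θ'}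
      ≤ ENNReal.ofReal (Real.exp (-(N * ((1 - ε) * Δ)))) := by
  rcases hΔ.eq_or_lt with rfl | hΔ
  · simp [prob_le_one]
  have hlt : (((1 - ε) * Δ : ℝ) : EReal) < rateMiss P₀ P₁ θ :=
    (EReal.coe_lt_coe_iff.2 (by nlinarith)).trans_le h
  simp only [rateMiss, lt_iSup_iff] at hlt
  obtain ⟨α, hα, hlt⟩ := hlt
  filter_upwards [eventually_lintegral_exp_le hlt] with θ' hθ' N
  refine le_trans (measure_mono fun x hx => ?_)
    (iidLaw_chernoff (measurable_llr P₁ P₀) hθ' N)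
  exact mul_le_mul_of_nonpos_left (le_of_lt hx) hα.le

end Tails

/-- Since `m N ≤ N`, a deviation of order `N` is at least one of order `m N`, which the law of large
numbers excludes. Used with `m N = N` for the errors and `m N = ⌊η N⌋` for the delay. -/
lemma tendsto_iidLaw_deviation {Q : Measure X} [IsProbabilityMeasure Q] {f : X → ℝ}
    (hf : Measurable f) (hfi : Integrable f Q) {m : ℕ → ℕ} (hm : Tendsto m atTop atTop)
    (hmN : ∀ N, m N ≤ N) {δ : ℝ} (hδ : 0 < δ) {A : ∀ N : ℕ, Set (Fin N → X)}
    (hA : ∀ᶠ N : ℕ in atTop, ∀ x ∈ A N, δ * N ≤ |partialSum f (m N) x - m N * ∫ y, f y ∂Q|) :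
    Tendsto (fun N => iidLaw Q N (A N)) atTop (𝓝 0) := by
  have hlim : Tendsto (fun N => ENNReal.ofReal (meanDeviation Q f (m N) / m N * δ⁻¹)) atTop
      (𝓝 0) := by
    simpa using ENNReal.tendsto_ofReal
      (((tendsto_meanDeviation_div hf hfi).comp hm).mul_const δ⁻¹)
  refine tendsto_of_tendsto_of_tendsto_of_le_of_le' tendsto_const_nhds hlim
    (Eventually.of_forall fun _ => zero_le) ?_
  filter_upwards [hA, hm.eventually_gt_atTop 0] with N hN hpos
  have hpos' : (0 : ℝ) < m N := by exact_mod_cast hpos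
  have hle : (m N : ℝ) ≤ N := by exact_mod_cast hmN N
  refine (measure_mono fun x hx => ?_).trans ((iidLaw_deviation_le hf hfi (hmN N)
    (mul_pos hδ hpos')).trans_eq ?_)
  · exact (mul_le_mul_of_nonneg_left hle hδ.le).trans (hN x hx)
  · rw [div_mul_eq_div_div_swap, ← div_eq_mul_inv, div_right_comm, div_right_comm]

lemma thresholdRule_decideH1_subset {f : X → ℝ} (hf : Measurable f) (N : ℕ) (a b : ℝ) :
    (thresholdRule hf N a b).decideH1
      ⊆ {x | (thresholdRule hf N a b).time x < N} ∪ {x | b ≤ partialSum f N x} := by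
  rintro x (hx | hx)
  · exact Or.inl hx
  · exact Or.inr hx.2

lemma thresholdRule_decideH0_subset {f : X → ℝ} (hf : Measurable f) (N : ℕ) (a b : ℝ) :
    (thresholdRule hf N a b).decideH0 ⊆ {x | partialSum f N x < b} :=
  fun x hx => lt_of_not_ge (show ¬ b ≤ partialSum f N x from hx.2)

/-- If the level is reached at time `m`, the rule has stopped by `m`; otherwise use the horizon `N`.
-/
lemma expectedStop_thresholdRule_le {Q : Measure X} [IsProbabilityMeasure Q] {f : X → ℝ}
    (hf : Measurable f) (N m : ℕ) (a b : ℝ) :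
    (thresholdRule hf N a b).expectedStop Q
      ≤ m + N * (iidLaw Q N).real {x | partialSum f m x < a} := by
  set R := thresholdRule hf N a b
  have hm : MeasurableSet {x : Fin N → X | partialSum f m x < a} :=
    measurableSet_lt (measurable_partialSum hf m) measurable_const
  have hint : Integrable (fun x => (R.time x : ℝ)) (iidLaw Q N) := by
    refine Integrable.of_bound (C := N)
      (measurable_from_nat.comp R.measurable_time).aestronglyMeasurable
      (Eventually.of_forall fun x => ?_)
    rw [Real.norm_of_nonneg (Nat.cast_nonneg _)]
    exact_mod_cast R.time_le x
  have hind : Integrable (fun x => (N : ℝ) * {x | partialSum f m x < a}.indicator (fun _ => 1) x)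
      (iidLaw Q N) := ((integrable_const (1 : ℝ)).indicator hm).const_mul _
  have hint' : Integrable (fun x => (m : ℝ) + N * {x | partialSum f m x < a}.indicator (fun _ => 1) x)
      (iidLaw Q N) :=
    (integrable_const _).add hind
  refine (integral_mono hint hint' fun x => ?_).trans_eq ?_
  · by_cases hx : partialSum f m x < a
    · simp only [Set.indicator_apply, Set.mem_ofPred_eq, hx, if_true, mul_one]
      have : (R.time x : ℝ) ≤ N := by exact_mod_cast R.time_le x
      have : (0 : ℝ) ≤ m := Nat.cast_nonneg m
      linarith
    · simp only [Set.indicator_apply, Set.mem_ofPred_eq, hx, if_false, mul_zero, add_zero]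
      exact_mod_cast thresholdRule_time_le hf (not_lt.1 hx)
  · rw [integral_add (integrable_const _) hind, integral_const_mul,
      integral_indicator_const _ hm]
    simp

end

/-! ### Achievability by threshold rules. -/

section

variable {X : Type*} [MeasurableSpace X] {P₀ P₁ : Measure X} [IsProbabilityMeasure P₀]
  [IsProbabilityMeasure P₁]

/-- The threshold rules whose sums of log-likelihood ratios stop at the level `N a` and are finally
compared with `N θ` have vanishing false alarm probability. -/
lemma tendsto_falseAlarm_thresholdRule (h : IsLogLikelihoodRatio P₀ P₁ (llr P₁ P₀)) {a θ : ℝ}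
    (ha : 0 < a) (hθ : ∫ x, llr P₁ P₀ x ∂P₀ < θ) :
    Tendsto (fun N : ℕ => (thresholdRule h.measurable N (N * a) (N * θ)).falseAlarm P₀)
      atTop (𝓝 0) := by
  have h1 : Tendsto (fun N : ℕ => ENNReal.ofReal (Real.exp (-(N * a)))) atTop (𝓝 0) := by
    simpa using ENNReal.tendsto_ofReal (Real.tendsto_exp_neg_atTop_nhds_zero.comp
      (tendsto_natCast_atTop_atTop.atTop_mul_const ha))
  have h2 : Tendsto (fun N : ℕ => iidLaw P₀ N {x | N * θ ≤ partialSum (llr P₁ P₀) N x})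
      atTop (𝓝 0) := by
    refine tendsto_iidLaw_deviation h.measurable h.integrable_zero tendsto_id (fun N => le_rfl)
      (sub_pos.2 hθ) (Eventually.of_forall fun N x hx => ?_)
    have hx' : N * θ ≤ partialSum (llr P₁ P₀) N x := hx
    refine le_trans ?_ (le_abs_self _)
    simp only [id]
    linarith
  refine tendsto_of_tendsto_of_tendsto_of_le_of_le tendsto_const_nhds (by simpa using h1.add h2)
    (fun _ => zero_le) fun N => ?_
  exact ((measure_mono (thresholdRule_decideH1_subset _ _ _ _)).trans (measure_union_le _ _)).trans
    (add_le_add_left (iidLaw_thresholdRule_time_lt_le _ h.eq_withDensity_neg _ _ _) _)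

lemma tendsto_miss_thresholdRule (h : IsLogLikelihoodRatio P₀ P₁ (llr P₁ P₀)) {a θ : ℝ}
    (hθ : θ < ∫ x, llr P₁ P₀ x ∂P₁) :
    Tendsto (fun N : ℕ => (thresholdRule h.measurable N (N * a) (N * θ)).miss P₁)
      atTop (𝓝 0) := by
  refine tendsto_iidLaw_deviation h.measurable h.integrable_one tendsto_id (fun N => le_rfl)
      (sub_pos.2 hθ) (Eventually.of_forall fun N x hx => ?_)
  have hx' : partialSum (llr P₁ P₀) N x < N * θ := thresholdRule_decideH0_subset _ _ _ _ hx
  refine le_trans ?_ (neg_le_abs _)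
  simp only [id]
  linarith

/-- Under `P₁` the sum at time `⌊η N⌋` is close to `N η d`, above the level `N a`, so stopping later
has vanishing probability. -/
lemma limsup_expectedStop_thresholdRule_le (h : IsLogLikelihoodRatio P₀ P₁ (llr P₁ P₀))
    {a η : ℝ} (hη0 : 0 < η) (hη : η ≤ 1) (hd : 0 < ∫ x, llr P₁ P₀ x ∂P₁)
    (ha : a < η * ∫ x, llr P₁ P₀ x ∂P₁) (b : ℕ → ℝ) :
    limsup (fun N : ℕ => (((thresholdRule h.measurable N (N * a) (b N)).expectedStop P₁ / (N : ℝ)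
      : ℝ) : EReal)) atTop ≤ (η : EReal) := by
  set d := ∫ x, llr P₁ P₀ x ∂P₁ with hd_def
  set m : ℕ → ℕ := fun N => ⌊η * N⌋₊ with hm_def
  have hηN : Tendsto (fun N : ℕ => η * N) atTop atTop :=
    tendsto_natCast_atTop_atTop.const_mul_atTop hη0
  have hm : Tendsto m atTop atTop := tendsto_nat_floor_atTop.comp hηN
  have hmle : ∀ N, (m N : ℝ) ≤ η * N := fun N =>
    Nat.floor_le (mul_nonneg hη0.le (Nat.cast_nonneg _))
  have hmN : ∀ N, m N ≤ N := fun N => by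
    have h1 : η * N ≤ N := mul_le_of_le_one_left (Nat.cast_nonneg _) hη
    exact_mod_cast (hmle N).trans h1
  -- Half of the gap is the deviation; the other half, times `N`, absorbs the rounding loss, at most
  -- `d`, from the floor.
  have hδ : 0 < (η * d - a) / 2 := by linarith
  have hA : Tendsto (fun N => iidLaw P₁ N {x | partialSum (llr P₁ P₀) (m N) x < N * a})
      atTop (𝓝 0) := by
    refine tendsto_iidLaw_deviation h.measurable h.integrable_one hm hmN hδ ?_
    filter_upwards [(tendsto_natCast_atTop_atTop.atTop_mul_const hδ).eventually_ge_atTop d]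
      with N hN x hx
    have hx' : partialSum (llr P₁ P₀) (m N) x < N * a := hx
    have hfl : η * N - 1 < m N := Nat.sub_one_lt_floor _
    have hfl' := mul_lt_mul_of_pos_right hfl hd
    refine le_trans ?_ (neg_le_abs _)
    rw [← hd_def]
    linarith
  have hA' : Tendsto (fun N => (iidLaw P₁ N).real
      {x | partialSum (llr P₁ P₀) (m N) x < N * a}) atTop (𝓝 0) := by
    have := (ENNReal.tendsto_toReal ENNReal.zero_ne_top).comp hA
    rwa [ENNReal.toReal_zero] at this
  have hlim : Tendsto (fun N => ((η + (iidLaw P₁ N).real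
      {x | partialSum (llr P₁ P₀) (m N) x < N * a} : ℝ) : EReal)) atTop (𝓝 (η : EReal)) := by
    refine (continuous_coe_real_ereal.tendsto η).comp ?_
    simpa using hA'.const_add η
  rw [← hlim.limsup_eq]
  refine limsup_le_limsup ?_
  filter_upwards [eventually_gt_atTop 0] with N hN
  have hN' : (0 : ℝ) < N := by exact_mod_cast hN
  rw [EReal.coe_le_coe_iff, div_le_iff₀ hN']
  refine (expectedStop_thresholdRule_le h.measurable N (m N) _ _).trans ?_
  rw [add_mul, mul_comm (N : ℝ) (Measure.real _ _)]
  exact add_le_add_left (hmle N) _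

/-- Scaling down the exponents and bounding the delay away from zero makes a tuple that satisfies
the bounds achievable. -/
lemma isAchievable_of_rate (h : IsLogLikelihoodRatio P₀ P₁ (llr P₁ P₀))
    (hd : 0 < ∫ x, llr P₁ P₀ x ∂P₁) (hlt : ∫ x, llr P₁ P₀ x ∂P₀ < ∫ x, llr P₁ P₀ x ∂P₁)
    {ΔFA ΔM η ε θ : ℝ} (hFA0 : 0 ≤ ΔFA) (hM0 : 0 ≤ ΔM) (hη : η ∈ Set.Icc (0 : ℝ) 1)
    (hε : ε ∈ Set.Ioo (0 : ℝ) 1)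
    (hθ : θ ∈ Set.Icc (∫ x, llr P₁ P₀ x ∂P₀) (∫ x, llr P₁ P₀ x ∂P₁))
    (hFAη : ΔFA ≤ η * ∫ x, llr P₁ P₀ x ∂P₁) (hFA : (ΔFA : EReal) ≤ rateFA P₀ P₁ θ)
    (hM : (ΔM : EReal) ≤ rateMiss P₀ P₁ θ) :
    IsAchievable P₀ P₁ ((1 - ε) * ΔFA) ((1 - ε) * ΔM) (max η ε) := by
  have hε' : 0 < 1 - ε := sub_pos.2 hε.2
  -- At an endpoint of the interval the law of large numbers would not make both errors vanish; the
  -- tail bounds hold near `θ`, so the threshold can be moved strictly inside.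
  obtain ⟨θ', ⟨hθFA, hθM⟩, hθ0, hθ1⟩ : ∃ θ' ∈ {θ' | (∀ N : ℕ,
      iidLaw P₀ N {x | N * θ' ≤ partialSum (llr P₁ P₀) N x}
        ≤ ENNReal.ofReal (Real.exp (-(N * ((1 - ε) * ΔFA))))) ∧
      ∀ N : ℕ, iidLaw P₁ N {x | partialSum (llr P₁ P₀) N x < N * θ'}
        ≤ ENNReal.ofReal (Real.exp (-(N * ((1 - ε) * ΔM))))},
      θ' ∈ Set.Ioo (∫ x, llr P₁ P₀ x ∂P₀) (∫ x, llr P₁ P₀ x ∂P₁) := by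
    rw [← closure_Ioo hlt.ne] at hθ
    exact mem_closure_iff_nhds.1 hθ _ ((eventually_falseAlarm_tail_le hFA0 hε.1 hFA).and
      (eventually_miss_tail_le hM0 hε.1 hM))
  set d := ∫ x, llr P₁ P₀ x ∂P₁
  have hη' : 0 < max η ε := lt_max_of_lt_right hε.1
  have hηd : 0 < max η ε * d := mul_pos hη' hd
  -- Large enough for the exponent `(1 - ε) ΔFA`, yet below `max η ε * d` so that stopping is
  -- timely. The maximum keeps the level positive when `η = 0`.
  set a := (1 - ε) * (max η ε * d) with ha_def
  have ha : 0 < a := mul_pos hε' hηd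
  have haFA : (1 - ε) * ΔFA ≤ a := mul_le_mul_of_nonneg_left
    (hFAη.trans (mul_le_mul_of_nonneg_right (le_max_left _ _) hd.le)) hε'.le
  refine ⟨fun N => thresholdRule h.measurable N (N * a) (N * θ'), ?_, ?_, ?_, ?_, ?_⟩
  · rw [(tendsto_falseAlarm_thresholdRule h ha hθ0).limsup_eq]
    exact zero_lt_one
  · rw [(tendsto_miss_thresholdRule h hθ1).limsup_eq]
    exact zero_lt_one
  · refine le_liminf_exponent (Eventually.of_forall fun N => ?_)
    refine ((measure_mono (thresholdRule_decideH1_subset _ _ _ _)).trans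
      (measure_union_le _ _)).trans ?_
    rw [two_mul]
    refine add_le_add ((iidLaw_thresholdRule_time_lt_le _ h.eq_withDensity_neg _ _ _).trans ?_)
      (hθFA N)
    refine ENNReal.ofReal_le_ofReal (Real.exp_le_exp.2 (neg_le_neg ?_))
    exact mul_le_mul_of_nonneg_left haFA (Nat.cast_nonneg _)
  · refine le_liminf_exponent (Eventually.of_forall fun N => ?_)
    exact ((measure_mono (thresholdRule_decideH0_subset _ _ _ _)).trans (hθM N)).trans
      (le_mul_of_one_le_left' one_le_two)
  · refine limsup_expectedStop_thresholdRule_le h hη' (max_le hη.2 hε.2.le) hd ?_ _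
    change a < max η ε * d
    nlinarith [hε.1]

/-- The achievability part: every tuple that satisfies the stated bounds is in the region. -/
lemma subset_performanceRegion (h : IsLogLikelihoodRatio P₀ P₁ (llr P₁ P₀)) {d₀ d₁ : ℝ}
    (hd₀ : d₀ = -∫ x, llr P₁ P₀ x ∂P₀) (hd₁ : d₁ = ∫ x, llr P₁ P₀ x ∂P₁)
    (hpos₀ : 0 < d₀) (hpos₁ : 0 < d₁) :
    {t : ℝ × ℝ × ℝ | 0 ≤ t.1 ∧ 0 ≤ t.2.1 ∧ t.2.2 ∈ Set.Icc (0 : ℝ) 1 ∧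
        ∃ ν ∈ Set.Icc (0 : ℝ) 1,
          (t.1 : EReal) ≤ min ((t.2.2 * d₁ : ℝ) : EReal)
            (rateFA P₀ P₁ (d₁ - ν * (d₀ + d₁))) ∧
          (t.2.1 : EReal) ≤ rateMiss P₀ P₁ (d₁ - ν * (d₀ + d₁))}
      ⊆ performanceRegion P₀ P₁ := by
  rintro ⟨ΔFA, ΔM, η⟩ ⟨hFA0, hM0, hη, ν, hν, hFA, hM⟩
  simp only at hFA0 hM0 hη hFA hM
  rw [le_min_iff, EReal.coe_le_coe_iff] at hFA
  have hθ : d₁ - ν * (d₀ + d₁) ∈ Set.Icc (∫ x, llr P₁ P₀ x ∂P₀) (∫ x, llr P₁ P₀ x ∂P₁) := by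
    rw [← hd₁, ← neg_neg (∫ x, llr P₁ P₀ x ∂P₀), ← hd₀]
    have h1 := mul_nonneg hν.1 (add_pos hpos₀ hpos₁).le
    have h2 := mul_le_of_le_one_left (add_pos hpos₀ hpos₁).le hν.2
    constructor <;> linarith
  have hlim : Tendsto (fun ε : ℝ => ((1 - ε) * ΔFA, (1 - ε) * ΔM, max η ε)) (𝓝[>] 0)
      (𝓝 (ΔFA, ΔM, η)) := by
    have hc : Continuous fun ε : ℝ => ((1 - ε) * ΔFA, (1 - ε) * ΔM, max η ε) := by fun_prop
    have := (hc.tendsto 0).mono_left (nhdsWithin_le_nhds (s := Set.Ioi 0))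
    simpa [max_eq_left hη.1] using this
  refine mem_closure_of_tendsto hlim ?_
  filter_upwards [Ioo_mem_nhdsGT zero_lt_one] with ε hε
  have hε' : 0 ≤ 1 - ε := sub_nonneg.2 hε.2.le
  refine ⟨mul_nonneg hε' hFA0, mul_nonneg hε' hM0, ⟨le_max_of_le_left hη.1,
    max_le hη.2 hε.2.le⟩, isAchievable_of_rate h (hd₁ ▸ hpos₁) ?_ hFA0 hM0 hη hε hθ
    (hd₁ ▸ hFA.1) hFA.2 hM⟩
  linarith

end

end ODR

theorem theorem3 {X : Type*} [MeasurableSpace X] (P₀ P₁ : Measure X)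
    [IsProbabilityMeasure P₀] [IsProbabilityMeasure P₁] (hne : P₀ ≠ P₁)
    (h₀ : klDiv P₀ P₁ ≠ ∞) (h₁ : klDiv P₁ P₀ ≠ ∞)
    (d₀ d₁ : ℝ) (hd₀ : d₀ = (klDiv P₀ P₁).toReal) (hd₁ : d₁ = (klDiv P₁ P₀).toReal) :
    ODR.performanceRegion P₀ P₁ =
      {t : ℝ × ℝ × ℝ | 0 ≤ t.1 ∧ 0 ≤ t.2.1 ∧ t.2.2 ∈ Set.Icc (0 : ℝ) 1 ∧
        ∃ ν ∈ Set.Icc (0 : ℝ) 1,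
          (t.1 : EReal) ≤ min ((t.2.2 * d₁ : ℝ) : EReal)
            (ODR.rateFA P₀ P₁ (d₁ - ν * (d₀ + d₁))) ∧
          (t.2.1 : EReal) ≤ ODR.rateMiss P₀ P₁ (d₁ - ν * (d₀ + d₁))} := by
  -- Distinctness of the laws enters here: the converse divides by `d₀ + d₁` and the stopping level
  -- needs `d₁ > 0`.
  have hpos₀ : 0 < d₀ := by
    rw [hd₀]
    exact ENNReal.toReal_pos (fun h => hne (klDiv_eq_zero_iff.1 h)) h₀
  have hpos₁ : 0 < d₁ := by
    rw [hd₁]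
    exact ENNReal.toReal_pos (fun h => hne (klDiv_eq_zero_iff.1 h).symm) h₁
  have h := ODR.isLogLikelihoodRatio_llr h₀ h₁
  have hd₀' := hd₀.trans (ODR.toReal_klDiv_zero h₀)
  have hd₁' := hd₁.trans (toReal_klDiv_of_measure_eq (klDiv_ne_top_iff.1 h₁).1 (by simp))
  exact Set.Subset.antisymm (ODR.performanceRegion_subset h hd₀' hd₁' hpos₀ hpos₁)
    (ODR.subset_performanceRegion h hd₀' hd₁' hpos₀ hpos₁)
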